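/- Let $(W,S)$ be a Coxeter system of finite rank with length function $\ell$. For $s\in S$ put $\alpha_s=\{w\in W : \ell(sw)>\ell(w)\}$; the root system is $\Phi=\{w\alpha_s : w\in W, s\in S\}$ (a set of subsets of $W$), $-\alpha$ denotes the complement $W\setminus\alpha$, a root is positive if it contains $1$, and $\Pi=\{\alpha_s : s\in S\}$ is the root basis. A pair of distinct roots $\{\alpha,\beta\}$ is prenilpotent if $\alpha\cap\beta$ and $(-\alpha)\cap(-\beta)$ are nonempty; then $]\alpha,\beta[$ is the set of roots $\gamma\neq\alpha,\beta$ with $\alpha\cap\beta\subset\gamma$ and $(-\alpha)\cap(-\beta)\subset-\gamma$. Let $G$ be a group endowed with a twin root datum $\{U_\alpha\}_{\alpha\in\Phi}$, i.e. a family of subgroups such that, with $T=\bigcap_{\alpha\in\Phi}N_G(U_\alpha)$ and with $U_+$ (resp. $U_-$) the subgroup generated by the $U_\alpha$ (resp. $U_{-\alpha}$) for $\alpha$ positive: - $U_\alpha\neq\{1\}$ for all $\alpha\in\Phi$; - $[U_\alpha,U_\beta]\subset\langle U_\gamma : \gamma\in\,]\alpha,\beta[\,\rangle$ for each prenilpotent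 pair $\{\alpha,\beta\}$ of distinct roots; - for each $\alpha=\alpha_s\in\Pi$ and $u\in U_\alpha\setminus\{1\}$ there are $u',u''\in U_{-\alpha}$ such that $m(u)=u'uu''$ conjugates $U_\beta$ onto $U_{s\beta}$ for each $\beta\in\Phi$; - $U_{-\alpha}\not\subset U_+$ and $U_\alpha\not\subset U_-$ for each $\alpha\in\Pi$; - $G=T\,\langle U_\alpha : \alpha\in\Phi\rangle$. Put $N=T\,\langle m(u) : u\in U_\alpha\setminus\{1\},\ \alpha\in\Pi\rangle$. Suppose that: 1. $(W,S)$ is irreducible, non-spherical ($W$ is infinite) and non-affine (its Tits form, with matrix $(-\cos(\pi/m_{st}))_{s,t\in S}$, is not positive semidefinite); 2. for each $\alpha\in\Pi$, the group $U_\alpha$ is nilpotent. Let $H$ be a normal subgroup of $G$ such that $N/T(N\cap H)$ is finite. Let $G^\dagger$ be the subgroup of $G$ generated by all the root groups, let $H^\dagger=H\cap G^\dagger$ and let $\pi:G^\dagger\to G^\dagger/H^\dagger$ be the canonical projection. Then the map $$\prod_{\alpha\in\Pi}U_\alpha\longrightarrow G^\dagger/H^\dagger,\qquad (u_\alpha)_{\alpha\in\Pi}\longmapsto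 \pi\Bigl(\prod_{\alpha\in\Pi}u_\alpha\Bigr)$$ (with the product in $G^\dagger$ taken in any order of $\Pi$, the result not depending on the order) is a surjective group homomorphism. In particular, $G^\dagger/H^\dagger$ is nilpotent. -/

import Mathlib

open scoped Pointwise

noncomputable section

namespace CoxeterSystem

variable {B W : Type*} [Group W] {M : CoxeterMatrix B}

/-- The half `{w ∈ W | ℓ(s w) > ℓ(w)}` of `W` containing `1`, attached to the canonical
generator `s = cs.simple i`. -/
def simpleHalf (cs : CoxeterSystem M W) (i : B) : Set W :=
  {w | cs.length w < cs.length (cs.simple i * w)}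

/-- A root of `(W, S)`: a left translate of one of the halves `simpleHalf`. -/
def IsRoot (cs : CoxeterSystem M W) (α : Set W) : Prop :=
  ∃ (w : W) (i : B), α = w • cs.simpleHalf i

/-- The combinatorial root system `Φ` of `(W, S)`. -/
def Root (cs : CoxeterSystem M W) : Type _ := {α : Set W // cs.IsRoot α}

theorem compl_simpleHalf (cs : CoxeterSystem M W) (i : B) :
    (cs.simpleHalf i)ᶜ = cs.simple i • cs.simpleHalf i := by
  ext w
  have hne := cs.length_simple_mul_ne w i
  simp only [simpleHalf, Set.mem_compl_iff, Set.mem_ofPred_eq, Set.mem_smul_set_iff_inv_smul_mem,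
    smul_eq_mul, cs.inv_simple, cs.simple_mul_simple_cancel_left]
  omega

theorem IsRoot.smul {cs : CoxeterSystem M W} {α : Set W} (h : cs.IsRoot α) (w : W) :
    cs.IsRoot (w • α) := by
  obtain ⟨v, i, rfl⟩ := h
  exact ⟨w * v, i, by rw [mul_smul]⟩

theorem IsRoot.compl {cs : CoxeterSystem M W} {α : Set W} (h : cs.IsRoot α) :
    cs.IsRoot αᶜ := by
  obtain ⟨v, i, rfl⟩ := h
  exact ⟨v * cs.simple i, i, by rw [← Set.smul_set_compl, compl_simpleHalf, mul_smul]⟩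

/-- The simple root `α_i`; the root basis `Π` is the family `(α_i)` indexed by `B`, i.e. by the
canonical generators. -/
def simpleRoot (cs : CoxeterSystem M W) (i : B) : cs.Root :=
  ⟨cs.simpleHalf i, 1, i, by rw [one_smul]⟩

namespace Root

variable {cs : CoxeterSystem M W}

/-- The opposite root `-α`. -/
def opp (α : cs.Root) : cs.Root := ⟨α.1ᶜ, α.2.compl⟩

/-- The action of `W` on roots by left translation. -/
def translate (w : W) (α : cs.Root) : cs.Root := ⟨w • α.1, α.2.smul w⟩

/-- A root is positive if it contains `1`. -/
def IsPos (α : cs.Root) : Prop := (1 : W) ∈ α.1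

/-- The pair `{α, β}` is prenilpotent: `α ∩ β` and `(-α) ∩ (-β)` are both nonempty. -/
def Prenilpotent (α β : cs.Root) : Prop :=
  (α.1 ∩ β.1).Nonempty ∧ (α.opp.1 ∩ β.opp.1).Nonempty

/-- The closed interval `[α, β]`. -/
def closedInterval (α β : cs.Root) : Set cs.Root :=
  {γ | α.1 ∩ β.1 ⊆ γ.1 ∧ α.opp.1 ∩ β.opp.1 ⊆ γ.opp.1}

/-- The open interval `]α, β[ = [α, β] \ {α, β}`. -/
def openInterval (α β : cs.Root) : Set cs.Root :=
  closedInterval α β \ {α, β}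

end Root

end CoxeterSystem

namespace CoxeterMatrix

variable {B : Type*} (M : CoxeterMatrix B)

/-- The Coxeter graph: distinct `i`, `j` are joined when `m(i, j) ≠ 2`. (The value `m(i, j) = 0`
encodes `m(i, j) = ∞`.) -/
def graph : SimpleGraph B where
  Adj i j := i ≠ j ∧ M i j ≠ 2
  symm := ⟨fun i j h => ⟨h.1.symm, by rw [M.symmetric]; exact h.2⟩⟩
  loopless := ⟨fun _ h => h.1 rfl⟩

/-- Irreducible type: the Coxeter graph is connected (in particular nonempty). -/
def IsIrreducible : Prop := M.graph.Connected

/-- The matrix of the Tits form: entries `-cos(π / m(i, j))`, and `-1` when `m(i, j) = ∞`. -/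
def titsMatrix : Matrix B B ℝ :=
  Matrix.of fun i j => if M i j = 0 then -1 else -Real.cos (Real.pi / (M i j : ℝ))

end CoxeterMatrix

namespace CoxeterSystem

variable {B W : Type*} [Group W] {M : CoxeterMatrix B}

/-- Spherical type: the Coxeter group is finite. -/
def IsSpherical (_cs : CoxeterSystem M W) : Prop := Finite W

/-- Affine type (for an irreducible system of finite rank): non-spherical with positive
semidefinite Tits form. -/
def IsAffine (cs : CoxeterSystem M W) : Prop :=
  ¬ cs.IsSpherical ∧ M.titsMatrix.PosSemidef

end CoxeterSystem

namespace RootGroups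

open CoxeterSystem

variable {B W : Type*} [Group W] {M : CoxeterMatrix B} {cs : CoxeterSystem M W}
  {G : Type*} [Group G] (U : cs.Root → Subgroup G)

/-- `T`, the intersection of the normalizers of the root groups. -/
def torus : Subgroup G := ⨅ α : cs.Root, Subgroup.normalizer (U α : Set G)

/-- `U₊`, generated by the root groups of positive roots. -/
def uPlus : Subgroup G := ⨆ (α : cs.Root) (_ : α.IsPos), U α

/-- `U₋`, generated by the root groups of opposites of positive roots. -/
def uMinus : Subgroup G := ⨆ (α : cs.Root) (_ : α.IsPos), U α.opp

/-- `G†`, generated by all the root groups. -/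
def dagger : Subgroup G := ⨆ α : cs.Root, U α

/-- `m` is an element of the form `m(u) = u' u u''` with `u', u''` in the root group of
`-α_i`, and it conjugates each `U_β` onto `U_{s_i(β)}`. -/
def IsWeylLift (i : B) (u m : G) : Prop :=
  (∃ u' ∈ U (cs.simpleRoot i).opp, ∃ u'' ∈ U (cs.simpleRoot i).opp, m = u' * u * u'') ∧
  ∀ β : cs.Root, (U β).map (MulAut.conj m).toMonoidHom = U (Root.translate (cs.simple i) β)

/-- `N = T.⟨m(u) | u ∈ U_α \ {1}, α ∈ Π⟩`. Two elements `m(u)`, `m(v)` attached to the same simple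
root differ by an element of `T`, so it does not matter which of them are used as generators. -/
def weylNormalizer : Subgroup G :=
  torus U ⊔ Subgroup.closure
    {m | ∃ (i : B) (u : G), u ∈ U (cs.simpleRoot i) ∧ u ≠ 1 ∧ IsWeylLift U i u m}

/-- The family `(U_α)`, indexed by the root system of `(W, S)`, is a twin root datum for `G`. -/
structure IsTwinRootDatum : Prop where
  ne_bot : ∀ α : cs.Root, U α ≠ ⊥
  commutator_le : ∀ α β : cs.Root, α ≠ β → α.Prenilpotent β →
    ⁅U α, U β⁆ ≤ ⨆ γ ∈ Root.openInterval α β, U γ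
  exists_weylLift : ∀ i : B, ∀ u ∈ U (cs.simpleRoot i), u ≠ 1 → ∃ m : G, IsWeylLift U i u m
  not_le_uPlus : ∀ i : B, ¬ U (cs.simpleRoot i).opp ≤ uPlus U
  not_le_uMinus : ∀ i : B, ¬ U (cs.simpleRoot i) ≤ uMinus U
  generates : torus U ⊔ dagger U = ⊤

/-- The inclusion `U_α → G†`. -/
def toDagger (α : cs.Root) : U α →* dagger U := Subgroup.inclusion (le_iSup U α)

/-- The canonical projection `G† → G† / (H ∩ G†)`. -/
def daggerProj (H : Subgroup G) [H.Normal] :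
    dagger U →* dagger U ⧸ H.subgroupOf (dagger U) :=
  QuotientGroup.mk' (H.subgroupOf (dagger U))

end RootGroups

end

/-!
In the geometric representation, with simple vectors `e_i` and the Tits form `(·, ·)`, a root
`w • α_i` corresponds to the vector `w e_i`, and two nested roots `α_i` and `w • α_i` satisfy
`(e_i, w e_i) ≥ 1`. If `α_i` and `w • α_i` are nested for all `w` in a normal subgroup `W'` of
finite index in an irreducible `W`, then the Tits form is positive semidefinite:
* if `(e_i, w e_i) > 1` for some `w ∈ W'`, commutators with `s_i` make this value as large as we
  want, and projecting all root vectors to the hyperbolic plane spanned by `e_i` and `w e_i` shows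
  that `W` is dihedral;
* otherwise `(e_i, w e_i) = 1` on `W'`, the linear form `(w e_i, ·)` only depends on `w W'`, and the
  sum of the squares of these forms is an invariant form, hence proportional to the Tits form.

So let `W'` be the image of `N ∩ H` in `W`. In the non-affine case there is `w ∈ W'` such that
`α_i` and `w • α_i` are not nested, that is, `{α_i, -(w • α_i)}` is prenilpotent. The root groups
of the roots separating two chambers generate a nilpotent group, by Fitting's theorem along a
minimal gallery. Since `w` is induced by an element of `H`, the images of `U_{α_i}` and `U_{-α_i}`
modulo `H` therefore generate a nilpotent group. They are conjugate in it by the image of some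
`m(u)`, so they are equal. As `]-α_i, α_j[` is empty for `i ≠ j`, the images of the simple root
groups commute, and they generate the image of `G†` since they contain the images of the `m(u)`.
-/

noncomputable section

namespace RootGroups

open CoxeterSystem Polynomial.Chebyshev

section Sequences

theorem monotone_of_nonneg_of_sub_le_sub {f : ℕ → ℝ} (hf : ∀ n, 0 ≤ f n)
    (hconcave : ∀ n, f (n + 2) - f (n + 1) ≤ f (n + 1) - f n) : Monotone f := by
  refine monotone_nat_of_le_succ fun N => ?_
  by_contra! hlt
  have hanti : Antitone fun n => f (n + 1) - f n := antitone_nat_of_succ_le hconcave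
  have hlinear (m : ℕ) : f (N + m) ≤ f N + m * (f (N + 1) - f N) := by
    induction m with
    | zero => simp
    | succ m ih =>
      have := hanti (Nat.le_add_right N m)
      push_cast [← add_assoc] at this ⊢
      linarith
  obtain ⟨m, hm⟩ := exists_nat_gt (f N / (f N - f (N + 1)))
  rw [div_lt_iff₀ (by linarith)] at hm
  linarith [hlinear m, hf (N + m)]

theorem eq_zero_of_nonneg_of_linear_recurrence {f : ℕ → ℝ} {β : ℝ} (hβ : β < 1)
    (hf : ∀ n, 0 ≤ f n) (hrec : ∀ n, f (n + 2) = 2 * β * f (n + 1) - f n) : f 1 = 0 := by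
  have hmono : Monotone f := monotone_of_nonneg_of_sub_le_sub hf fun n => by
    nlinarith [hf (n + 1), hrec n]
  have hdecay (n : ℕ) : f (n + 1) - f n ≤ f 1 - f 0 - n * (2 * (1 - β) * f 1) := by
    induction n with
    | zero => simp
    | succ n ih =>
      push_cast
      nlinarith [hrec n, hmono (Nat.le_add_left 1 n)]
  by_contra h0
  have hstep : 0 < 2 * (1 - β) * f 1 :=
    mul_pos (by linarith) (lt_of_le_of_ne (hf 1) (Ne.symm h0))
  obtain ⟨n, hn⟩ := exists_nat_gt ((f 1 - f 0) / (2 * (1 - β) * f 1))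
  rw [div_lt_iff₀ hstep] at hn
  linarith [hdecay n, hmono n.le_succ]

theorem eval_S_two_mul_cos_eq_zero {k : ℤ} {θ : ℝ} (hθ : Real.sin θ ≠ 0) (hk : k * θ = Real.pi) :
    (S ℝ (k - 1)).eval (2 * Real.cos θ) = 0 := by
  refine (mul_eq_zero.1 ?_).resolve_right hθ
  rw [S_two_mul_real_cos]
  push_cast
  rw [sub_add_cancel, hk, Real.sin_pi]

theorem eval_S_two_mul_cos_add_eq_zero {k : ℤ} {θ : ℝ} (hθ : Real.sin θ ≠ 0)
    (hk : (2 * k + 1) * θ = 2 * Real.pi) :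
    (S ℝ k).eval (2 * Real.cos θ) + (S ℝ (k - 1)).eval (2 * Real.cos θ) = 0 := by
  refine (mul_eq_zero.1 ?_).resolve_right hθ
  rw [add_mul, S_two_mul_real_cos, S_two_mul_real_cos,
    show (k + 1 : ℝ) * θ = 2 * Real.pi - k * θ by linarith, Real.sin_two_pi_sub]
  push_cast
  rw [sub_add_cancel, neg_add_cancel]

/-- These are the coefficients in `Module.reflection_mul_reflection_pow_apply`. -/
theorem eval_S_two_mul_cos_coeffs_eq_zero {m : ℕ} {θ : ℝ} (hθ : Real.sin θ ≠ 0)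
    (hm : m * θ = 2 * Real.pi) :
    (S ℝ ((m - 2) / 2)).eval (2 * Real.cos θ) * ((S ℝ ((m - 1) / 2)).eval (2 * Real.cos θ) +
        (S ℝ ((m - 3) / 2)).eval (2 * Real.cos θ)) = 0 ∧
      (S ℝ ((m - 1) / 2)).eval (2 * Real.cos θ) * ((S ℝ (m / 2)).eval (2 * Real.cos θ) +
        (S ℝ ((m - 2) / 2)).eval (2 * Real.cos θ)) = 0 := by
  obtain ⟨k, rfl | rfl⟩ := m.even_or_odd'
  · have h := eval_S_two_mul_cos_eq_zero (k := k) hθ (by push_cast at hm ⊢; linarith)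
    rw [show ((2 * k : ℕ) - 1 : ℤ) / 2 = k - 1 by omega,
      show ((2 * k : ℕ) - 2 : ℤ) / 2 = k - 1 by omega, h, zero_mul, zero_mul]
    exact ⟨rfl, rfl⟩
  · have h := eval_S_two_mul_cos_add_eq_zero (k := k) hθ (by exact_mod_cast hm)
    rw [show ((2 * k + 1 : ℕ) - 1 : ℤ) / 2 = k by omega,
      show ((2 * k + 1 : ℕ) - 2 : ℤ) / 2 = k - 1 by omega,
      show ((2 * k + 1 : ℕ) - 3 : ℤ) / 2 = k - 1 by omega,
      show ((2 * k + 1 : ℕ) : ℤ) / 2 = k by omega, h, mul_zero, mul_zero]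
    exact ⟨rfl, rfl⟩

end Sequences

section TitsMatrix

variable {B : Type*} (M : CoxeterMatrix B)

theorem titsMatrix_self (i : B) : M.titsMatrix i i = 1 := by
  simp [CoxeterMatrix.titsMatrix]

theorem titsMatrix_comm (i j : B) : M.titsMatrix i j = M.titsMatrix j i := by
  simp [CoxeterMatrix.titsMatrix, M.symmetric i j]

theorem titsMatrix_of_eq_zero {i j : B} (h : M i j = 0) : M.titsMatrix i j = -1 := by
  simp [CoxeterMatrix.titsMatrix, h]

theorem titsMatrix_of_ne_zero {i j : B} (h : M i j ≠ 0) :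
    M.titsMatrix i j = -Real.cos (Real.pi / M i j) := by
  simp [CoxeterMatrix.titsMatrix, h]

theorem neg_one_le_titsMatrix (i j : B) : -1 ≤ M.titsMatrix i j := by
  by_cases h : M i j = 0
  · exact (titsMatrix_of_eq_zero M h).ge
  · rw [titsMatrix_of_ne_zero M h]
    exact neg_le_neg (Real.cos_le_one _)

theorem two_le_of_ne {i j : B} (hij : i ≠ j) (h : M i j ≠ 0) : 2 ≤ M i j := by
  have := M.off_diagonal i j hij
  omega

theorem pi_div_mem_Ioc {i j : B} (hij : i ≠ j) (h : M i j ≠ 0) :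
    Real.pi / M i j ∈ Set.Ioc 0 (Real.pi / 2) := by
  have hm : (2 : ℝ) ≤ M i j := by exact_mod_cast two_le_of_ne M hij h
  have := Real.pi_pos
  exact ⟨by positivity, by gcongr⟩

theorem titsMatrix_nonpos {i j : B} (hij : i ≠ j) : M.titsMatrix i j ≤ 0 := by
  by_cases h : M i j = 0
  · rw [titsMatrix_of_eq_zero M h]
    norm_num
  · obtain ⟨hpos, hle⟩ := pi_div_mem_Ioc M hij h
    rw [titsMatrix_of_ne_zero M h, neg_nonpos]
    exact Real.cos_nonneg_of_mem_Icc ⟨by linarith [Real.pi_pos], hle⟩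

theorem titsMatrix_ne_zero_of_adj {i j : B} (hadj : M.graph.Adj i j) : M.titsMatrix i j ≠ 0 := by
  by_cases h : M i j = 0
  · rw [titsMatrix_of_eq_zero M h]
    norm_num
  · have hm : (2 : ℝ) < M i j := by
      exact_mod_cast (two_le_of_ne M hadj.1 h).lt_of_ne hadj.2.symm
    have := Real.pi_pos
    rw [titsMatrix_of_ne_zero M h, neg_ne_zero]
    refine (Real.cos_pos_of_mem_Ioo ⟨?_, by gcongr⟩).ne'
    linarith [(pi_div_mem_Ioc M hadj.1 h).1]

theorem eval_S_neg_two_mul_titsMatrix_nonneg {i j : B} (hij : i ≠ j) {n : ℤ} (hn : -1 ≤ n)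
    (hnM : M i j ≠ 0 → n + 1 ≤ M i j) : 0 ≤ (S ℝ n).eval (-2 * M.titsMatrix i j) := by
  have hn0 : (0 : ℝ) ≤ n + 1 := by exact_mod_cast Int.add_le_add_right hn 1
  by_cases h : M i j = 0
  · rw [titsMatrix_of_eq_zero M h, neg_mul_neg, mul_one, S_eval_two]
    exact hn0
  · obtain ⟨hpos, hle⟩ := pi_div_mem_Ioc M hij h
    rw [titsMatrix_of_ne_zero M h, neg_mul_neg]
    refine nonneg_of_mul_nonneg_left ?_
      (Real.sin_pos_of_pos_of_lt_pi hpos (by linarith [Real.pi_pos]))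
    rw [S_two_mul_real_cos]
    refine Real.sin_nonneg_of_nonneg_of_le_pi (by positivity) ?_
    calc (n + 1) * (Real.pi / M i j) ≤ M i j * (Real.pi / M i j) := by
          have : (n + 1 : ℝ) ≤ M i j := by exact_mod_cast hnM h
          gcongr
      _ = Real.pi := by field_simp

end TitsMatrix

section TitsForm

variable {B : Type*} (M : CoxeterMatrix B)

/-- The basis vector of the geometric representation attached to a canonical generator. -/
abbrev simpleVec (i : B) : B →₀ ℝ := Finsupp.single i 1

/-- The Tits form, the symmetric bilinear form with matrix `M.titsMatrix` in the basis of simple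
vectors. -/
def titsForm : LinearMap.BilinForm ℝ (B →₀ ℝ) :=
  Finsupp.linearCombination ℝ fun i => Finsupp.linearCombination ℝ (M.titsMatrix i)

theorem titsForm_simpleVec (i j : B) :
    titsForm M (simpleVec i) (simpleVec j) = M.titsMatrix i j := by
  simp [titsForm]

theorem titsForm_simpleVec_self (i : B) : titsForm M (simpleVec i) (simpleVec i) = 1 := by
  rw [titsForm_simpleVec, titsMatrix_self]

theorem titsForm_comm (x y : B →₀ ℝ) : titsForm M x y = titsForm M y x := by
  suffices titsForm M = (titsForm M).flip from LinearMap.congr_fun₂ this x y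
  ext i j
  simp [titsForm, titsMatrix_comm M i j]

theorem posSemidef_titsMatrix_of_titsForm_self_nonneg (h : ∀ x, 0 ≤ titsForm M x x) :
    M.titsMatrix.PosSemidef := by
  refine ⟨by ext i j; simp [titsMatrix_comm M i j], fun x => ?_⟩
  simpa [titsForm, Finsupp.linearCombination_apply, Finsupp.sum, LinearMap.sum_apply,
    Finset.mul_sum, mul_assoc, mul_comm (M.titsMatrix _ _)] using h x

theorem two_smul_titsForm_self {a : B →₀ ℝ} (ha : titsForm M a a = 1) :
    ((2 : ℝ) • titsForm M a) a = 2 := by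
  simp [ha]

/-- The orthogonal reflection, with respect to the Tits form, in the hyperplane orthogonal to a
vector `a` of norm `1`. For other `a` the map is not a reflection. -/
def refl (a : B →₀ ℝ) : Module.End ℝ (B →₀ ℝ) := Module.preReflection a ((2 : ℝ) • titsForm M a)

theorem refl_apply (a x : B →₀ ℝ) : refl M a x = x - (2 * titsForm M a x) • a := rfl

theorem refl_self {a : B →₀ ℝ} (ha : titsForm M a a = 1) : refl M a a = -a :=
  Module.preReflection_apply_self (two_smul_titsForm_self M ha)

theorem refl_mul_self {a : B →₀ ℝ} (ha : titsForm M a a = 1) : refl M a * refl M a = 1 :=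
  LinearMap.ext fun x => Module.involutive_preReflection (two_smul_titsForm_self M ha) x

theorem titsForm_refl_right (a b x : B →₀ ℝ) :
    titsForm M b (refl M a x) = titsForm M b x - 2 * titsForm M a x * titsForm M b a := by
  simp [refl_apply]

theorem titsForm_refl_refl {a : B →₀ ℝ} (ha : titsForm M a a = 1) (x y : B →₀ ℝ) :
    titsForm M (refl M a x) (refl M a y) = titsForm M x y := by
  simp only [refl_apply, map_sub, map_smul, LinearMap.sub_apply,
    LinearMap.smul_apply, smul_eq_mul, ha, titsForm_comm M x a]
  ring

theorem refl_simpleVec (i j : B) :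
    refl M (simpleVec i) (simpleVec j) = simpleVec j - (2 * M.titsMatrix i j) • simpleVec i := by
  rw [refl_apply, titsForm_simpleVec]

theorem refl_mul_refl_sq {a b : B →₀ ℝ} (ha : titsForm M a a = 1) (hb : titsForm M b b = 1)
    (hab : titsForm M a b = 0) : (refl M a * refl M b) ^ 2 = 1 := by
  refine LinearMap.ext fun x => ?_
  simp only [pow_two, Module.End.mul_apply, Module.End.one_apply, refl_apply, map_sub, map_smul,
    ha, hb, hab, titsForm_comm M b a]
  module

theorem refl_mul_refl_pow_eq_one {a b : B →₀ ℝ} (ha : titsForm M a a = 1)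
    (hb : titsForm M b b = 1) {m : ℕ} (hm : 2 < m)
    (hab : titsForm M a b = -Real.cos (Real.pi / m)) : (refl M a * refl M b) ^ m = 1 := by
  have hf := two_smul_titsForm_self M ha
  have hg := two_smul_titsForm_self M hb
  set θ := 2 * (Real.pi / m) with hθ
  have hm' : (2 : ℝ) < m := by exact_mod_cast hm
  have hmθ : m * θ = 2 * Real.pi := by
    rw [hθ]
    field_simp
  have hsin : Real.sin θ ≠ 0 := by
    have := Real.pi_pos
    exact (Real.sin_pos_of_pos_of_lt_pi (by positivity) (by nlinarith)).ne'
  have ht : 2 * Real.cos θ = ((2 : ℝ) • titsForm M a) b * ((2 : ℝ) • titsForm M b) a - 2 := by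
    simp only [LinearMap.smul_apply, titsForm_comm M b a, hab, smul_eq_mul, hθ, Real.cos_two_mul]
    ring
  obtain ⟨hcoeff₁, hcoeff₂⟩ := eval_S_two_mul_cos_coeffs_eq_zero hsin hmθ
  refine LinearMap.ext fun z => ?_
  have hpow := Module.reflection_mul_reflection_pow_apply hf hg m z _ ht
  rw [LinearEquiv.pow_apply] at hpow
  rw [Module.End.pow_apply]
  refine hpow.trans ?_
  rw [hcoeff₁, hcoeff₂, zero_smul, zero_smul, add_zero, add_zero]
  rfl

theorem isLiftable_refl : M.IsLiftable fun i => refl M (simpleVec i) := by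
  intro i j
  have hi := titsForm_simpleVec_self M i
  have hj := titsForm_simpleVec_self M j
  obtain rfl | hij := eq_or_ne i j
  · rw [refl_mul_self M hi, one_pow]
  by_cases h : M i j = 0
  · rw [h, pow_zero]
  have hform := (titsForm_simpleVec M i j).trans (titsMatrix_of_ne_zero M h)
  obtain hm | hm := (two_le_of_ne M hij h).eq_or_lt
  · rw [← hm] at hform ⊢
    exact refl_mul_refl_sq M hi hj (by simpa using hform)
  · exact refl_mul_refl_pow_eq_one M hi hj hm hform

end TitsForm

section GeometricRepresentation

variable {B W : Type*} [Group W] {M : CoxeterMatrix B} (cs : CoxeterSystem M W)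

/-- The geometric representation of a Coxeter group: the canonical generators act as the
reflections in the simple vectors. -/
def geomRep : W →* Module.End ℝ (B →₀ ℝ) := cs.lift ⟨_, isLiftable_refl M⟩

theorem geomRep_simple (i : B) : geomRep cs (cs.simple i) = refl M (simpleVec i) :=
  cs.lift_apply_simple _ i

theorem geomRep_mul_apply (v w : W) (x : B →₀ ℝ) :
    geomRep cs (v * w) x = geomRep cs v (geomRep cs w x) := by
  rw [map_mul, Module.End.mul_apply]

theorem geomRep_one_apply (x : B →₀ ℝ) : geomRep cs 1 x = x := by
  rw [map_one, Module.End.one_apply]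

theorem geomRep_inv_apply_apply (w : W) (x : B →₀ ℝ) :
    geomRep cs w⁻¹ (geomRep cs w x) = x := by
  rw [← geomRep_mul_apply, inv_mul_cancel, geomRep_one_apply]

theorem geomRep_apply_inv_apply (w : W) (x : B →₀ ℝ) :
    geomRep cs w (geomRep cs w⁻¹ x) = x := by
  simpa only [inv_inv] using geomRep_inv_apply_apply cs w⁻¹ x

theorem titsForm_geomRep (w : W) (x y : B →₀ ℝ) :
    titsForm M (geomRep cs w x) (geomRep cs w y) = titsForm M x y := by
  induction w using cs.simple_induction_left with
  | one => simp only [geomRep_one_apply]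
  | mul_simple_left w i ih =>
    rw [geomRep_mul_apply, geomRep_mul_apply, geomRep_simple,
      titsForm_refl_refl M (titsForm_simpleVec_self M i), ih]

theorem titsForm_geomRep_left (w : W) (x y : B →₀ ℝ) :
    titsForm M (geomRep cs w x) y = titsForm M x (geomRep cs w⁻¹ y) := by
  rw [← titsForm_geomRep cs w x, geomRep_apply_inv_apply]

theorem geomRep_conj_simple (w : W) (i : B) :
    geomRep cs (w * cs.simple i * w⁻¹) = refl M (geomRep cs w (simpleVec i)) := by
  refine LinearMap.ext fun x => ?_
  rw [geomRep_mul_apply, geomRep_mul_apply, geomRep_simple, refl_apply, refl_apply, map_sub,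
    map_smul, geomRep_apply_inv_apply, titsForm_geomRep_left]

/-- A root vector is a vector in the orbit of a simple vector; these are the roots in the sense of
the geometric representation, and the elements of `cs.Root` are the associated half-spaces. -/
def IsRootVec (b : B →₀ ℝ) : Prop := ∃ (w : W) (i : B), b = geomRep cs w (simpleVec i)

theorem isRootVec_simpleVec (i : B) : IsRootVec cs (simpleVec i) :=
  ⟨1, i, (geomRep_one_apply cs _).symm⟩

namespace IsRootVec

variable {cs} {a b : B →₀ ℝ}

protected theorem geomRep (hb : IsRootVec cs b) (w : W) : IsRootVec cs (geomRep cs w b) := by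
  obtain ⟨x, j, rfl⟩ := hb
  exact ⟨w * x, j, (geomRep_mul_apply cs w x _).symm⟩

theorem exists_geomRep_eq_refl (hb : IsRootVec cs b) : ∃ r : W, geomRep cs r = refl M b := by
  obtain ⟨x, j, rfl⟩ := hb
  exact ⟨_, geomRep_conj_simple cs x j⟩

protected theorem refl (hb : IsRootVec cs b) (ha : IsRootVec cs a) :
    IsRootVec cs (refl M a b) := by
  obtain ⟨r, hr⟩ := ha.exists_geomRep_eq_refl
  exact hr ▸ hb.geomRep r

theorem titsForm_self (hb : IsRootVec cs b) : titsForm M b b = 1 := by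
  obtain ⟨x, j, rfl⟩ := hb
  rw [titsForm_geomRep, titsForm_simpleVec_self]

protected theorem neg (hb : IsRootVec cs b) : IsRootVec cs (-b) := by
  simpa only [refl_self M hb.titsForm_self] using hb.refl hb

theorem ne_zero (hb : IsRootVec cs b) : b ≠ 0 := by
  rintro rfl
  simpa using hb.titsForm_self

end IsRootVec

end GeometricRepresentation

section Positivity

variable {B W : Type*} [Group W] {M : CoxeterMatrix B} (cs : CoxeterSystem M W)

theorem geomRep_alternatingWord (i j : B) (n : ℕ) :
    geomRep cs (cs.wordProd (alternatingWord i j n)) (simpleVec i) =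
      (S ℝ n).eval (-2 * M.titsMatrix i j) • simpleVec (if Even n then i else j) +
        (S ℝ (n - 1)).eval (-2 * M.titsMatrix i j) • simpleVec (if Even n then j else i) := by
  induction n with
  | zero => simp [alternatingWord]
  | succ n ih =>
    have hrec : (S ℝ (n + 1)).eval (-2 * M.titsMatrix i j) =
        -2 * M.titsMatrix i j * (S ℝ n).eval (-2 * M.titsMatrix i j) -
          (S ℝ (n - 1)).eval (-2 * M.titsMatrix i j) := by
      simp [S_add_one]
    rw [alternatingWord_succ', wordProd_cons, geomRep_mul_apply, ih, geomRep_simple]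
    push_cast
    rw [add_sub_cancel_right, hrec]
    by_cases hn : Even n <;>
    · simp only [hn, Nat.even_add_one, not_true, not_false_iff, if_true, if_false, map_add,
        map_smul, refl_simpleVec, titsMatrix_self, titsMatrix_comm M j i]
      module

theorem length_alternatingWord_mul_simple_lt {i j : B} (h : M i j ≠ 0) {n : ℕ} (hn : M i j ≤ n) :
    cs.length (cs.wordProd (alternatingWord i j n) * cs.simple i) < n := by
  induction n, hn using Nat.le_induction with
  | base =>
    obtain ⟨m, hm⟩ := Nat.exists_eq_succ_of_ne_zero h
    have hbraid := cs.wordProd_braidWord_eq i j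
    rw [braidWord, braidWord, M.symmetric j i] at hbraid
    rw [hbraid, hm, alternatingWord_succ, wordProd_concat, mul_assoc, simple_mul_simple_self,
      mul_one, Nat.lt_succ_iff]
    simpa using cs.length_wordProd_le (alternatingWord i j m)
  | succ n _ ih =>
    rw [alternatingWord_succ', wordProd_cons, mul_assoc]
    refine (cs.length_mul_le _ _).trans_lt ?_
    rw [length_simple]
    omega

theorem exists_eq_mul_alternatingWord_not_isRightDescent (w : W) (i j : B) :
    ∃ (v : W) (n : ℕ), w = v * cs.wordProd (alternatingWord i j n) ∧
      cs.length w = cs.length v + n ∧ ¬ cs.IsRightDescent v (if Even n then j else i) := by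
  suffices ∀ (l : ℕ) (v : W) (n : ℕ), cs.length v = l →
      w = v * cs.wordProd (alternatingWord i j n) → cs.length w = cs.length v + n → _ from
    this _ w 0 rfl (by simp [alternatingWord]) rfl
  intro l
  induction l with
  | zero =>
    refine fun v n hv hw hlen => ⟨v, n, hw, hlen, fun hd => ?_⟩
    exact absurd hd (by simp [IsRightDescent, hv])
  | succ l ih =>
    intro v n hv hw hlen
    by_cases hd : cs.IsRightDescent v (if Even n then j else i)
    · rw [cs.isRightDescent_iff] at hd
      refine ih (v * cs.simple (if Even n then j else i)) (n + 1) (by omega) ?_ (by omega)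
      rw [alternatingWord_succ', wordProd_cons, mul_assoc, simple_mul_simple_cancel_left, hw]
    · exact ⟨v, n, hw, hlen, hd⟩

theorem exists_eq_mul_alternatingWord {w : W} {i : B} (j : B) (hi : ¬ cs.IsRightDescent w i) :
    ∃ (v : W) (n : ℕ), w = v * cs.wordProd (alternatingWord i j n) ∧
      cs.length w = cs.length v + n ∧ ¬ cs.IsRightDescent v i ∧ ¬ cs.IsRightDescent v j := by
  obtain ⟨v, n, hw, hlen, hnext⟩ := exists_eq_mul_alternatingWord_not_isRightDescent cs w i j
  have hprev : ¬ cs.IsRightDescent v (if Even n then i else j) := by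
    cases n with
    | zero =>
      obtain rfl : w = v := by simpa [alternatingWord] using hw
      simpa using hi
    | succ m =>
      intro hd
      rw [if_congr Nat.even_add_one rfl rfl, ite_not, cs.isRightDescent_iff] at hd
      rw [alternatingWord_succ', wordProd_cons, ← mul_assoc] at hw
      have hle := cs.length_mul_le (v * cs.simple (if Even m then j else i))
        (cs.wordProd (alternatingWord i j m))
      have hword := cs.length_wordProd_le (alternatingWord i j m)
      rw [← hw] at hle
      rw [length_alternatingWord] at hword
      omega
  refine ⟨v, n, hw, hlen, ?_⟩
  split_ifs at hnext hprev
  exacts [⟨hprev, hnext⟩, ⟨hnext, hprev⟩]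

theorem geomRep_simpleVec_nonneg {w : W} {i : B} (hi : ¬ cs.IsRightDescent w i) :
    0 ≤ geomRep cs w (simpleVec i) := by
  induction hl : cs.length w using Nat.strong_induction_on generalizing w i with
  | _ l ih =>
  subst hl
  obtain rfl | hw := eq_or_ne w 1
  · rw [geomRep_one_apply]
    exact Finsupp.single_nonneg.2 zero_le_one
  obtain ⟨j, hj⟩ := cs.exists_rightDescent_of_ne_one hw
  have hij : i ≠ j := by
    rintro rfl
    exact hi hj
  obtain ⟨v, n, hwv, hlen, hvi, hvj⟩ := exists_eq_mul_alternatingWord cs j hi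
  have hn : n ≠ 0 := by
    rintro rfl
    rw [hwv] at hj
    exact hvj (by simpa [alternatingWord] using hj)
  have hnM (h : M i j ≠ 0) : n < M i j := by
    by_contra! hle
    refine hi ?_
    have := length_alternatingWord_mul_simple_lt cs h hle
    have := cs.length_mul_le v (cs.wordProd (alternatingWord i j n) * cs.simple i)
    rw [← mul_assoc, ← hwv] at this
    rw [IsRightDescent]
    omega
  have hpos (k : B) (hk : k = i ∨ k = j) : 0 ≤ geomRep cs v (simpleVec k) :=
    ih _ (by omega) (by rcases hk with rfl | rfl <;> assumption) rfl
  rw [hwv, geomRep_mul_apply, geomRep_alternatingWord, map_add, map_smul, map_smul]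
  refine add_nonneg (smul_nonneg ?_ (hpos _ (by split_ifs <;> simp)))
    (smul_nonneg ?_ (hpos _ (by split_ifs <;> simp)))
  · exact eval_S_neg_two_mul_titsMatrix_nonneg M hij (by omega) fun h => by
      have := hnM h
      omega
  · exact eval_S_neg_two_mul_titsMatrix_nonneg M hij (by omega) fun h => by
      have := hnM h
      omega

theorem geomRep_simpleVec_nonpos {w : W} {i : B} (hi : cs.IsRightDescent w i) :
    geomRep cs w (simpleVec i) ≤ 0 := by
  have := geomRep_simpleVec_nonneg cs (cs.isRightDescent_iff_not_isRightDescent_mul.1 hi)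
  rwa [geomRep_mul_apply, geomRep_simple, refl_self M (titsForm_simpleVec_self M i), map_neg,
    neg_nonneg] at this

theorem geomRep_simpleVec_nonneg_iff {w : W} {i : B} :
    0 ≤ geomRep cs w (simpleVec i) ↔ ¬ cs.IsRightDescent w i :=
  ⟨fun h hi => ((isRootVec_simpleVec cs i).geomRep w).ne_zero
    (le_antisymm (geomRep_simpleVec_nonpos cs hi) h), geomRep_simpleVec_nonneg cs⟩

theorem IsRootVec.nonneg_or_nonpos {cs : CoxeterSystem M W} {b : B →₀ ℝ} (hb : IsRootVec cs b) :
    0 ≤ b ∨ b ≤ 0 := by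
  obtain ⟨w, i, rfl⟩ := hb
  by_cases hi : cs.IsRightDescent w i
  · exact Or.inr (geomRep_simpleVec_nonpos cs hi)
  · exact Or.inl (geomRep_simpleVec_nonneg cs hi)

theorem mem_smul_simpleHalf_iff {x w : W} {i : B} :
    x ∈ w • cs.simpleHalf i ↔ 0 ≤ geomRep cs (x⁻¹ * w) (simpleVec i) := by
  rw [geomRep_simpleVec_nonneg_iff, Set.mem_smul_set_iff_inv_smul_mem, smul_eq_mul, simpleHalf,
    ← cs.isLeftDescent_inv_iff, mul_inv_rev, inv_inv, IsLeftDescent, Set.mem_ofPred_eq]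
  have := cs.length_simple_mul_ne (w⁻¹ * x) i
  omega

end Positivity

section NestedRoots

variable {B W : Type*} [Group W] {M : CoxeterMatrix B} (cs : CoxeterSystem M W)

/-- The root vector `a` dominates the root vector `b` (in the sense of Brink and Howlett) if every
element of `W` keeping `a` nonnegative keeps `b` nonnegative. -/
def Dominates (a b : B →₀ ℝ) : Prop := ∀ x : W, 0 ≤ geomRep cs x a → 0 ≤ geomRep cs x b

variable {cs} {a b : B →₀ ℝ}

theorem Dominates.neg_refl (h : Dominates cs a b) (ha : IsRootVec cs a) (hb : IsRootVec cs b) :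
    Dominates cs b (-refl M b a) := by
  intro x hx
  obtain ⟨r, hr⟩ := hb.exists_geomRep_eq_refl
  rw [map_neg, ← hr, ← geomRep_mul_apply, neg_nonneg]
  refine (ha.geomRep (x * r)).nonneg_or_nonpos.resolve_left fun hxa => ?_
  have hxb := h _ hxa
  rw [geomRep_mul_apply, hr, refl_self M hb.titsForm_self, map_neg, neg_nonneg] at hxb
  exact (hb.geomRep x).ne_zero (le_antisymm hxb hx)

/-- If `β = (a, b) < 1`, the roots `a`, `b`, `2βb - a`, … obtained by iterating
`Dominates.neg_refl` would give nonnegative solutions of `f (n + 2) = 2βf (n + 1) - f n`. -/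
theorem Dominates.one_le_titsForm (h : Dominates cs a b) (ha : IsRootVec cs a)
    (hb : IsRootVec cs b) : 1 ≤ titsForm M a b := by
  by_contra! hlt
  let step : (B →₀ ℝ) × (B →₀ ℝ) → (B →₀ ℝ) × (B →₀ ℝ) := fun p => (p.2, -refl M p.2 p.1)
  have hstep (n : ℕ) : step^[n + 1] (a, b) =
      ((step^[n] (a, b)).2, -refl M (step^[n] (a, b)).2 (step^[n] (a, b)).1) :=
    Function.iterate_succ_apply' _ _ _
  have hinv (n : ℕ) : IsRootVec cs (step^[n] (a, b)).1 ∧ IsRootVec cs (step^[n] (a, b)).2 ∧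
      Dominates cs (step^[n] (a, b)).1 (step^[n] (a, b)).2 ∧
        titsForm M (step^[n] (a, b)).1 (step^[n] (a, b)).2 = titsForm M a b := by
    induction n with
    | zero => exact ⟨ha, hb, h, rfl⟩
    | succ n ih =>
      obtain ⟨ha', hb', h', hform⟩ := ih
      rw [hstep]
      refine ⟨hb', (ha'.refl hb').neg, h'.neg_refl ha' hb', ?_⟩
      rw [map_neg, titsForm_refl_right, hb'.titsForm_self, titsForm_comm M _ (_ : _ × _).1, hform]
      ring
  obtain ⟨x, hx⟩ : ∃ x : W, 0 ≤ geomRep cs x a := by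
    obtain ⟨u, i, rfl⟩ := ha
    refine ⟨u⁻¹, ?_⟩
    rw [geomRep_inv_apply_apply]
    exact Finsupp.single_nonneg.2 zero_le_one
  have hnonneg (n : ℕ) : 0 ≤ geomRep cs x (step^[n] (a, b)).1 := by
    induction n with
    | zero => exact hx
    | succ n ih =>
      rw [hstep]
      exact (hinv n).2.2.1 x ih
  refine (hb.geomRep x).ne_zero (Finsupp.ext fun l => ?_)
  refine eq_zero_of_nonneg_of_linear_recurrence
    (f := fun n => geomRep cs x (step^[n] (a, b)).1 l) hlt (fun n => hnonneg n l) fun n => ?_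
  simp only [hstep, refl_apply, titsForm_comm M (_ : _ × _).2, (hinv n).2.2.2, neg_sub, map_sub,
    map_smul, Finsupp.sub_apply, Finsupp.smul_apply, smul_eq_mul]

theorem one_le_titsForm_of_subset {u v : W} {i j : B}
    (h : u • cs.simpleHalf i ⊆ v • cs.simpleHalf j) :
    1 ≤ titsForm M (geomRep cs u (simpleVec i)) (geomRep cs v (simpleVec j)) := by
  refine Dominates.one_le_titsForm (cs := cs) (fun x hx => ?_)
    ((isRootVec_simpleVec cs i).geomRep u) ((isRootVec_simpleVec cs j).geomRep v)
  rw [← geomRep_mul_apply] at hx ⊢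
  have hmem : x⁻¹ ∈ v • cs.simpleHalf j :=
    h ((mem_smul_simpleHalf_iff cs).2 (by rwa [inv_inv]))
  rwa [mem_smul_simpleHalf_iff, inv_inv] at hmem

end NestedRoots

section HyperbolicPlane

variable {B W : Type*} [Group W] {M : CoxeterMatrix B} {cs : CoxeterSystem M W}
  {a a' b b₁ b₂ : B →₀ ℝ}

variable (M) in
/-- For unit vectors `a` and `a'`, this is `1 - (a, a') ^ 2` times the norm of the orthogonal
projection of `b` to the span of `a` and `a'`. -/
def planeDisc (a a' b : B →₀ ℝ) : ℝ :=
  titsForm M a b ^ 2 - 2 * titsForm M a a' * titsForm M a b * titsForm M a' b +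
    titsForm M a' b ^ 2

theorem planeDisc_refl_left (ha : titsForm M a a = 1) :
    planeDisc M a a' (refl M a b) = planeDisc M a a' b := by
  simp only [planeDisc, titsForm_refl_right, ha, titsForm_comm M a' a]
  ring

theorem planeDisc_refl_right (ha' : titsForm M a' a' = 1) :
    planeDisc M a a' (refl M a' b) = planeDisc M a a' b := by
  simp only [planeDisc, titsForm_refl_right, ha']
  ring

theorem planeDisc_mul_le (ha : titsForm M a a = 1)
    (hdisc : ∀ u : W, planeDisc M a a' (geomRep cs u a) ≤ 0) (hb : IsRootVec cs b) :
    4 * titsForm M a b ^ 2 * (titsForm M a a' ^ 2 - 1 + planeDisc M a a' b) ≤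
      titsForm M a a' ^ 2 - 1 := by
  obtain ⟨r, hr⟩ := hb.exists_geomRep_eq_refl
  have hra := hdisc r
  simp only [hr, planeDisc, titsForm_refl_right, ha, titsForm_comm M b a, titsForm_comm M a' a]
    at hra
  simp only [planeDisc]
  linarith

/-- The product of the reflections in `a` and `a'` is hyperbolic on the plane they span, so that its
orbits off the orthogonal of that plane are unbounded. -/
theorem titsForm_eq_zero_of_abs_le (ha : titsForm M a a = 1) (hlt : 1 < titsForm M a a')
    {s : Set (B →₀ ℝ)} (hs : ∀ b ∈ s, refl M a b ∈ s) (hs' : ∀ b ∈ s, refl M a' b ∈ s) {C : ℝ}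
    (hC : ∀ b ∈ s, |titsForm M a b| ≤ C) (hb : b ∈ s) : titsForm M a b = 0 := by
  set q := 2 * titsForm M a a' ^ 2 - 1 with hq
  have hq1 : 1 < q := by nlinarith
  have hpow (n : ℕ) : ∀ b ∈ s, q ^ n * |titsForm M a b| ≤ C := by
    induction n with
    | zero => simpa using hC
    | succ n ih =>
      intro b hb
      have hsub : 2 * q * titsForm M a b =
          titsForm M a (refl M a' (refl M a b)) - titsForm M a (refl M a' b) := by
        simp only [hq, titsForm_refl_right, ha, titsForm_comm M a' a]
        ring
      have habs : 2 * q * |titsForm M a b| ≤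
          |titsForm M a (refl M a' (refl M a b))| + |titsForm M a (refl M a' b)| := by
        rw [← abs_of_pos (by linarith : 0 < 2 * q), ← abs_mul, hsub]
        exact abs_sub _ _
      have hmul := mul_le_mul_of_nonneg_left habs (by positivity : 0 ≤ q ^ n)
      have h₁ := ih _ (hs' _ (hs _ hb))
      have h₂ := ih _ (hs' _ hb)
      rw [pow_succ]
      linarith
  by_contra hne
  obtain ⟨n, hn⟩ := pow_unbounded_of_one_lt (C / |titsForm M a b|) hq1
  rw [div_lt_iff₀ (abs_pos.2 hne)] at hn
  exact (hpow n b hb).not_gt hn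

variable (cs) in
/-- Every root vector is orthogonal to both `a` and `a'` or has, when `1 < (a, a')`, a projection
of norm at least `1` to the hyperbolic plane spanned by `a` and `a'`. -/
def HasLargeProjections (a a' : B →₀ ℝ) : Prop :=
  ∀ b, IsRootVec cs b → (titsForm M a b = 0 ∧ titsForm M a' b = 0) ∨
    planeDisc M a a' b ≤ 1 - titsForm M a a' ^ 2

theorem hasLargeProjections_of_planeDisc_nonpos (ha : IsRootVec cs a) (ha' : IsRootVec cs a')
    (hlt : 1 < titsForm M a a') (hdisc : ∀ u : W, planeDisc M a a' (geomRep cs u a) ≤ 0) :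
    HasLargeProjections cs a a' := by
  intro b hb
  rw [or_iff_not_imp_right, not_le]
  intro hF
  have hE : 0 < titsForm M a a' ^ 2 - 1 + planeDisc M a a' b := by linarith
  set s := {c | IsRootVec cs c ∧ planeDisc M a a' c = planeDisc M a a' b}
  have hs : ∀ c ∈ s, refl M a c ∈ s := fun c hc =>
    ⟨hc.1.refl ha, (planeDisc_refl_left ha.titsForm_self).trans hc.2⟩
  have hs' : ∀ c ∈ s, refl M a' c ∈ s := fun c hc =>
    ⟨hc.1.refl ha', (planeDisc_refl_right ha'.titsForm_self).trans hc.2⟩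
  have horth : ∀ c ∈ s, titsForm M a c = 0 := fun c hc => by
    refine titsForm_eq_zero_of_abs_le ha.titsForm_self hlt hs hs'
      (C := √((titsForm M a a' ^ 2 - 1) / (4 * (titsForm M a a' ^ 2 - 1 + planeDisc M a a' b))))
      (fun x hx => Real.abs_le_sqrt ?_) hc
    rw [le_div_iff₀ (by positivity)]
    have := planeDisc_mul_le ha.titsForm_self hdisc hx.1
    rw [hx.2] at this
    linarith
  have hab := horth b ⟨hb, rfl⟩
  have hrefl := horth _ (hs' b ⟨hb, rfl⟩)
  rw [titsForm_refl_right, hab, zero_sub, neg_eq_zero] at hrefl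
  refine ⟨hab, ?_⟩
  have hne : titsForm M a a' ≠ 0 := by positivity
  simpa [hne] using hrefl

theorem HasLargeProjections.simpleVec_dichotomy {i j : B}
    (h : HasLargeProjections cs (simpleVec i) a') (hlt : 1 < titsForm M (simpleVec i) a')
    (hij : i ≠ j) :
    (M.titsMatrix i j = 0 ∧ titsForm M a' (simpleVec j) = 0) ∨
      (M.titsMatrix i j = -1 ∧ titsForm M a' (simpleVec j) = -titsForm M (simpleVec i) a') := by
  obtain h | h := h _ (isRootVec_simpleVec cs j)
  · exact Or.inl (by rwa [titsForm_simpleVec] at h)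
  right
  rw [planeDisc, titsForm_simpleVec] at h
  set k := titsForm M (simpleVec i) a'
  set c := M.titsMatrix i j
  set d := titsForm M a' (simpleVec j)
  have hc₀ : c ≤ 0 := titsMatrix_nonpos M hij
  have hc₁ : -1 ≤ c := neg_one_le_titsMatrix M i j
  have hsq : (d - k * c) ^ 2 + (k ^ 2 - 1) * (1 - c ^ 2) ≤ 0 := by linarith
  have hk : 0 < k ^ 2 - 1 := by nlinarith
  have hc : c = -1 := by
    refine hc₁.antisymm' (le_of_not_gt fun hgt => ?_)
    have : 0 < (k ^ 2 - 1) * (1 - c ^ 2) := mul_pos hk (by nlinarith)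
    linarith [sq_nonneg (d - k * c)]
  rw [hc] at hsq
  have hd : d + k = 0 := by
    rw [← sq_eq_zero_iff]
    exact le_antisymm (by linarith) (sq_nonneg _)
  exact ⟨hc, by linarith⟩

/-- Otherwise the image of `b₂` under the reflections in `a'`, `a` and `b₁` would have too small a
projection to the plane of `a` and `a'`. -/
theorem HasLargeProjections.one_le_titsForm_of_same_projection (h : HasLargeProjections cs a a')
    (ha : IsRootVec cs a) (ha' : IsRootVec cs a') (hlt : 2 < titsForm M a a')
    (hb₁ : IsRootVec cs b₁) (hb₂ : IsRootVec cs b₂)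
    (hab₁ : titsForm M a b₁ = -1) (hab₁' : titsForm M a' b₁ = -titsForm M a a')
    (hab₂ : titsForm M a b₂ = -1) (hab₂' : titsForm M a' b₂ = -titsForm M a a')
    (hlow : -2 ≤ titsForm M b₁ b₂) : 1 ≤ titsForm M b₁ b₂ := by
  by_contra! hx
  have hproj := h _ (((hb₂.refl ha').refl ha).refl hb₁)
  simp only [planeDisc, titsForm_refl_right, titsForm_comm M b₁ a, titsForm_comm M b₁ a',
    titsForm_comm M a' a, ha.titsForm_self, ha'.titsForm_self, hab₁, hab₁', hab₂, hab₂'] at hproj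
  set k := titsForm M a a'
  set x := titsForm M b₁ b₂
  have hk : 4 < k ^ 2 := by nlinarith
  obtain ⟨h₁, h₂⟩ | hdisc := hproj
  · have : k * (k ^ 2 - 1) = 0 := by linear_combination (k * h₁ - h₂) / 2
    rcases mul_eq_zero.1 this with _ | _ <;> linarith
  · have hpos : 0 < (k ^ 2 - 1) * ((x - 2 + 2 * k ^ 2) * (1 - x)) :=
      mul_pos (by linarith) (mul_pos (by linarith) (by linarith))
    linarith

end HyperbolicPlane

section NestedConjugates

open scoped commutatorElement

variable {B W : Type*} [Group W] {M : CoxeterMatrix B} {cs : CoxeterSystem M W} {i : B}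

theorem forall_of_adj {V : Type*} {Γ : SimpleGraph V} (hΓ : Γ.Preconnected) {p : V → Prop} {a : V}
    (ha : p a) (hp : ∀ b c, p b → Γ.Adj b c → p c) (b : V) : p b := by
  induction (SimpleGraph.reachable_iff_reflTransGen a b).1 (hΓ a b) with
  | refl => exact ha
  | tail _ hadj ih => exact hp _ _ ih hadj

theorem titsForm_commutator (v : W) (i : B) :
    titsForm M (simpleVec i) (geomRep cs ⁅cs.simple i, v⁆ (simpleVec i)) =
      2 * titsForm M (simpleVec i) (geomRep cs v (simpleVec i)) ^ 2 - 1 := by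
  have hcomm : ⁅cs.simple i, v⁆ = cs.simple i * (v * cs.simple i * v⁻¹) := by
    simp only [commutatorElement_def, inv_simple, mul_assoc]
  simp only [hcomm, geomRep_mul_apply cs (cs.simple i), geomRep_conj_simple, geomRep_simple,
    titsForm_refl_right, titsForm_simpleVec_self,
    titsForm_comm M (geomRep cs v (simpleVec i))]
  ring

variable {W' : Subgroup W} [W'.Normal]

theorem commutator_mem_of_mem_right {v : W} (hv : v ∈ W') (x : W) : ⁅x, v⁆ ∈ W' :=
  Subgroup.commutator_le_right ⊤ W' (Subgroup.commutator_mem_commutator (Subgroup.mem_top x) hv)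

theorem exists_two_lt_titsForm {w : W} (hw : w ∈ W')
    (hlt : 1 < titsForm M (simpleVec i) (geomRep cs w (simpleVec i))) :
    ∃ v ∈ W', 2 < titsForm M (simpleVec i) (geomRep cs v (simpleVec i)) := by
  set δ := titsForm M (simpleVec i) (geomRep cs w (simpleVec i)) - 1
  have hδ₀ : 0 < δ := by linarith
  have hpow (n : ℕ) : ∃ v ∈ W',
      1 + 4 ^ n * δ ≤ titsForm M (simpleVec i) (geomRep cs v (simpleVec i)) := by
    induction n with
    | zero => exact ⟨w, hw, by linarith⟩
    | succ n ih =>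
      obtain ⟨v, hv, hle⟩ := ih
      refine ⟨_, commutator_mem_of_mem_right hv (cs.simple i), ?_⟩
      have : 0 < 4 ^ n * δ := by positivity
      rw [titsForm_commutator, pow_succ]
      nlinarith
  obtain ⟨n, hn⟩ := pow_unbounded_of_one_lt (1 / δ) (by norm_num : (1 : ℝ) < 4)
  rw [div_lt_iff₀ hδ₀] at hn
  obtain ⟨v, hv, hle⟩ := hpow n
  exact ⟨v, hv, by linarith⟩

/-- With `s` and `r` the reflections in `a = e_i` and `w a`, the element `u⁻¹ s r u = u⁻¹ [s, w] u`
lies in `W'`. -/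
theorem planeDisc_nonpos
    (hW' : ∀ w ∈ W', 1 ≤ titsForm M (simpleVec i) (geomRep cs w (simpleVec i)))
    {w : W} (hw : w ∈ W') (u : W) :
    planeDisc M (simpleVec i) (geomRep cs w (simpleVec i)) (geomRep cs u (simpleVec i)) ≤ 0 := by
  have hmem : u⁻¹ * (cs.simple i * (w * cs.simple i * w⁻¹)) * u ∈ W' := by
    simpa only [commutatorElement_def, inv_simple, inv_inv, mul_assoc] using
      Subgroup.Normal.conj_mem ‹_› _ (commutator_mem_of_mem_right hw (cs.simple i)) u⁻¹
  have hle : 1 ≤ titsForm M (geomRep cs u (simpleVec i)) (refl M (simpleVec i)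
      (refl M (geomRep cs w (simpleVec i)) (geomRep cs u (simpleVec i)))) := by
    rw [← geomRep_conj_simple, ← geomRep_simple cs i, ← geomRep_mul_apply cs (cs.simple i),
      titsForm_geomRep_left, ← geomRep_mul_apply, ← geomRep_mul_apply]
    exact hW' _ hmem
  rw [titsForm_refl_right, titsForm_refl_right, titsForm_refl_right, titsForm_geomRep cs u,
    titsForm_simpleVec_self, titsForm_comm M (geomRep cs u _) (simpleVec i),
    titsForm_comm M (geomRep cs u _) (geomRep cs w _)] at hle
  rw [planeDisc]
  linarith

end NestedConjugates

section Hyperbolic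

variable {B W : Type*} [Group W] {M : CoxeterMatrix B} {cs : CoxeterSystem M W} {i : B}
  {a : B →₀ ℝ}

theorem HasLargeProjections.titsMatrix_eq_neg_one (h : HasLargeProjections cs (simpleVec i) a)
    (ha : IsRootVec cs a) (hlt : 2 < titsForm M (simpleVec i) a) (hirr : M.IsIrreducible) {j : B}
    (hij : i ≠ j) :
    M.titsMatrix i j = -1 ∧ titsForm M a (simpleVec j) = -titsForm M (simpleVec i) a := by
  suffices ∀ j, i = j ∨ M.titsMatrix i j = -1 ∧
      titsForm M a (simpleVec j) = -titsForm M (simpleVec i) a from (this j).resolve_left hij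
  refine forall_of_adj (SimpleGraph.Connected.preconnected hirr) (Or.inl rfl) fun j l hj hadj => ?_
  rw [or_iff_not_imp_left]
  intro hil
  refine (h.simpleVec_dichotomy (by linarith) hil).resolve_left ?_
  rintro ⟨hl, hal⟩
  have hjl := titsMatrix_ne_zero_of_adj M hadj
  obtain rfl | ⟨hj, haj⟩ := hj
  · exact hjl hl
  have hform : titsForm M (simpleVec j) (refl M (simpleVec l) (simpleVec j)) =
      1 - 2 * M.titsMatrix j l ^ 2 := by
    simp only [titsForm_refl_right, titsForm_simpleVec, titsMatrix_self, titsMatrix_comm M l j]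
    ring
  have hle := h.one_le_titsForm_of_same_projection (b₁ := simpleVec j)
    (b₂ := refl M (simpleVec l) (simpleVec j)) (isRootVec_simpleVec cs i) ha hlt
    (isRootVec_simpleVec cs j) ((isRootVec_simpleVec cs j).refl (isRootVec_simpleVec cs l))
    (by rw [titsForm_simpleVec, hj]) haj
    (by simp [titsForm_refl_right, titsForm_simpleVec, hl, hj])
    (by simp [titsForm_refl_right, hal, haj])
    (by
      rw [hform]
      nlinarith [neg_one_le_titsMatrix M j l, titsMatrix_nonpos M hadj.1])
  rw [hform] at hle
  have : 0 < M.titsMatrix j l ^ 2 := by positivity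
  linarith

theorem HasLargeProjections.eq_of_ne (h : HasLargeProjections cs (simpleVec i) a)
    (ha : IsRootVec cs a) (hlt : 2 < titsForm M (simpleVec i) a) (hirr : M.IsIrreducible) {j l : B}
    (hij : i ≠ j) (hil : i ≠ l) : j = l := by
  by_contra hjl
  obtain ⟨hj, haj⟩ := h.titsMatrix_eq_neg_one ha hlt hirr hij
  obtain ⟨hl, hal⟩ := h.titsMatrix_eq_neg_one ha hlt hirr hil
  have hle := h.one_le_titsForm_of_same_projection (isRootVec_simpleVec cs i) ha hlt
    (isRootVec_simpleVec cs j) (isRootVec_simpleVec cs l) (by rw [titsForm_simpleVec, hj]) haj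
    (by rw [titsForm_simpleVec, hl]) hal
    (by rw [titsForm_simpleVec]; linarith [neg_one_le_titsMatrix M j l])
  rw [titsForm_simpleVec] at hle
  linarith [titsMatrix_nonpos M hjl]

theorem HasLargeProjections.posSemidef_titsMatrix (h : HasLargeProjections cs (simpleVec i) a)
    (ha : IsRootVec cs a) (hlt : 2 < titsForm M (simpleVec i) a) (hirr : M.IsIrreducible) :
    M.titsMatrix.PosSemidef := by
  classical
  let ε : B → ℝ := fun j => if i = j then 1 else -1
  have hε (j l : B) : M.titsMatrix j l = ε j * ε l := by
    by_cases hij : i = j <;> by_cases hil : i = l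
    · simp [ε, ← hij, ← hil, titsMatrix_self]
    · simp [ε, ← hij, hil, (h.titsMatrix_eq_neg_one ha hlt hirr hil).1]
    · simp [ε, ← hil, hij, titsMatrix_comm M j i, (h.titsMatrix_eq_neg_one ha hlt hirr hij).1]
    · simp [ε, hij, h.eq_of_ne ha hlt hirr hil hij, titsMatrix_self]
  have hform : titsForm M =
      (Finsupp.linearCombination ℝ ε).smulRight (Finsupp.linearCombination ℝ ε) := by
    ext j l
    simp [titsForm, hε]
  refine posSemidef_titsMatrix_of_titsForm_self_nonneg M fun x => ?_
  rw [hform]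
  exact mul_self_nonneg _

end Hyperbolic

section Parabolic

variable {B W : Type*} [Group W] {M : CoxeterMatrix B} {cs : CoxeterSystem M W}

theorem eq_smul_titsForm_of_invariant (hirr : M.IsIrreducible) {E : LinearMap.BilinForm ℝ (B →₀ ℝ)}
    (hsymm : ∀ x y, E x y = E y x)
    (hinv : ∀ (g : W) (x y), E (geomRep cs g x) (geomRep cs g y) = E x y) (i : B) :
    E = E (simpleVec i) (simpleVec i) • titsForm M := by
  have hsimple (j : B) (y : B →₀ ℝ) :
      E (simpleVec j) y = E (simpleVec j) (simpleVec j) * titsForm M (simpleVec j) y := by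
    have hj := hinv (cs.simple j) (simpleVec j) y
    simp only [geomRep_simple, refl_self M (titsForm_simpleVec_self M j), refl_apply, map_neg,
      map_sub, map_smul, LinearMap.neg_apply, smul_eq_mul] at hj
    linarith
  have hconst : ∀ j, E (simpleVec j) (simpleVec j) = E (simpleVec i) (simpleVec i) := by
    refine forall_of_adj (SimpleGraph.Connected.preconnected hirr) rfl fun j l hj hadj => ?_
    have hjl := hsimple j (simpleVec l)
    rw [hsymm, hsimple l, titsForm_simpleVec, titsForm_simpleVec, titsMatrix_comm M l j] at hjl
    exact (mul_right_cancel₀ (titsMatrix_ne_zero_of_adj M hadj) hjl).trans hj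
  ext j l
  simpa [hconst] using hsimple j (simpleVec l)

theorem posSemidef_titsMatrix_of_invariant (hirr : M.IsIrreducible)
    {E : LinearMap.BilinForm ℝ (B →₀ ℝ)} (hsymm : ∀ x y, E x y = E y x)
    (hinv : ∀ (g : W) (x y), E (geomRep cs g x) (geomRep cs g y) = E x y)
    (hnonneg : ∀ x, 0 ≤ E x x) {i : B} (hpos : 0 < E (simpleVec i) (simpleVec i)) :
    M.titsMatrix.PosSemidef := by
  refine posSemidef_titsMatrix_of_titsForm_self_nonneg M fun x => ?_
  refine nonneg_of_mul_nonneg_right ?_ hpos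
  rw [← smul_eq_mul, ← LinearMap.smul_apply, ← LinearMap.smul_apply,
    ← eq_smul_titsForm_of_invariant hirr hsymm hinv]
  exact hnonneg x

variable {i : B} {W' : Subgroup W} [W'.Normal]

theorem titsForm_geomRep_eq_of_forall_eq_one (hirr : M.IsIrreducible)
    (hW' : ∀ w ∈ W', titsForm M (simpleVec i) (geomRep cs w (simpleVec i)) = 1) {w : W}
    (hw : w ∈ W') : titsForm M (geomRep cs w (simpleVec i)) = titsForm M (simpleVec i) := by
  set φ : Module.Dual ℝ (B →₀ ℝ) :=
    titsForm M (geomRep cs w (simpleVec i)) - titsForm M (simpleVec i) with hφ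
  have horth : ∀ j, ∀ u : W, φ (geomRep cs u (simpleVec j)) = 0 := by
    refine forall_of_adj (SimpleGraph.Connected.preconnected hirr) (a := i) (fun u => ?_)
      fun j l hj hadj u => ?_
    · have hdisc := planeDisc_nonpos (fun w hw => (hW' w hw).ge) hw u
      rw [planeDisc, hW' w hw] at hdisc
      rw [hφ, LinearMap.sub_apply, ← sq_eq_zero_iff]
      exact le_antisymm (by linarith) (sq_nonneg _)
    · have hl := hj (u * cs.simple l)
      rw [geomRep_mul_apply, geomRep_simple, refl_simpleVec, map_sub, map_smul, map_sub, hj,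
        map_smul, zero_sub, neg_eq_zero, smul_eq_mul] at hl
      refine (mul_eq_zero.1 hl).resolve_left (mul_ne_zero two_ne_zero ?_)
      rw [titsMatrix_comm M l j]
      exact titsMatrix_ne_zero_of_adj M hadj
  ext j
  have hj := horth j 1
  rw [geomRep_one_apply, hφ, LinearMap.sub_apply, sub_eq_zero] at hj
  simpa using hj

/-- The linear forms `(w e_i, ·)` only depend on `w W'`; the sum of their squares is a nonzero
invariant form, hence proportional to the Tits form. -/
theorem posSemidef_titsMatrix_of_forall_eq_one [W'.FiniteIndex] (hirr : M.IsIrreducible)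
    (hW' : ∀ w ∈ W', titsForm M (simpleVec i) (geomRep cs w (simpleVec i)) = 1) :
    M.titsMatrix.PosSemidef := by
  have : Fintype (W ⧸ W') := Fintype.ofFinite _
  let Q : W ⧸ W' → Module.Dual ℝ (B →₀ ℝ) :=
    fun q => titsForm M (geomRep cs q.out (simpleVec i))
  have hQ (u : W) : Q u = titsForm M (geomRep cs u (simpleVec i)) := by
    obtain ⟨⟨v, hv⟩, hu⟩ := QuotientGroup.mk_out_eq_mul W' u
    refine LinearMap.ext fun x => ?_
    simp only [Q, hu, geomRep_mul_apply, titsForm_geomRep_left cs u,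
      titsForm_geomRep_eq_of_forall_eq_one hirr hW' hv]
  have hQ_smul (g : W) (q : W ⧸ W') (x : B →₀ ℝ) : Q (g • q) (geomRep cs g x) = Q q x := by
    induction q using QuotientGroup.induction_on with
    | H u => rw [MulAction.Quotient.smul_coe, smul_eq_mul, hQ, hQ, geomRep_mul_apply,
        titsForm_geomRep]
  let E : LinearMap.BilinForm ℝ (B →₀ ℝ) := ∑ q, LinearMap.BilinForm.linMulLin (Q q) (Q q)
  have hE (x y : B →₀ ℝ) : E x y = ∑ q, Q q x * Q q y := by
    simp [E, LinearMap.sum_apply]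
  refine posSemidef_titsMatrix_of_invariant (cs := cs) (E := E) (i := i) hirr
    (fun x y => by simp only [hE, mul_comm]) (fun g x y => ?_) (fun x => ?_) ?_
  · rw [hE, hE, ← Equiv.sum_comp (MulAction.toPerm g)]
    simp only [MulAction.toPerm_apply, hQ_smul]
  · rw [hE]
    exact Finset.sum_nonneg fun q _ => mul_self_nonneg _
  · rw [hE]
    refine Finset.sum_pos' (fun q _ => mul_self_nonneg _) ⟨(1 : W), Finset.mem_univ _, ?_⟩
    rw [hQ, geomRep_one_apply, titsForm_simpleVec_self, mul_one]
    exact zero_lt_one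

theorem posSemidef_titsMatrix_of_one_le [W'.FiniteIndex] (hirr : M.IsIrreducible)
    (hW' : ∀ w ∈ W', 1 ≤ titsForm M (simpleVec i) (geomRep cs w (simpleVec i))) :
    M.titsMatrix.PosSemidef := by
  by_cases h : ∃ w ∈ W', 1 < titsForm M (simpleVec i) (geomRep cs w (simpleVec i))
  · obtain ⟨w, hw, hlt⟩ := h
    obtain ⟨v, hv, hlt⟩ := exists_two_lt_titsForm hw hlt
    have hi := isRootVec_simpleVec cs i
    exact (hasLargeProjections_of_planeDisc_nonpos hi (hi.geomRep v) (by linarith)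
      (planeDisc_nonpos hW' hv)).posSemidef_titsMatrix (hi.geomRep v) hlt hirr
  · push Not at h
    exact posSemidef_titsMatrix_of_forall_eq_one hirr fun w hw => (h w hw).antisymm (hW' w hw)

variable (cs) in
theorem exists_mem_not_nested (hirr : M.IsIrreducible) (hpos : ¬ M.titsMatrix.PosSemidef)
    (W' : Subgroup W) [W'.Normal] [W'.FiniteIndex] (i : B) :
    ∃ w ∈ W', ¬ cs.simpleHalf i ⊆ w • cs.simpleHalf i ∧
      ¬ w • cs.simpleHalf i ⊆ cs.simpleHalf i := by
  by_contra! hnested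
  refine hpos (posSemidef_titsMatrix_of_one_le hirr (W' := W') (i := i) (cs := cs) fun w hw => ?_)
  by_cases h : cs.simpleHalf i ⊆ w • cs.simpleHalf i
  · simpa only [geomRep_one_apply] using
      one_le_titsForm_of_subset (cs := cs) (u := 1) (v := w) (by rwa [one_smul])
  · rw [titsForm_comm]
    simpa only [geomRep_one_apply] using
      one_le_titsForm_of_subset (cs := cs) (u := w) (v := 1)
        (by rw [one_smul]; exact hnested w hw h)

end Parabolic

section NilpotentSubgroups

open Subgroup
open scoped commutatorElement

variable {G : Type*} [Group G]

theorem commutator_le_iff_le_comap_centralizer {X Y N : Subgroup G} [N.Normal] :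
    ⁅X, Y⁆ ≤ N ↔ X ≤ (centralizer (Y.map (QuotientGroup.mk' N) : Set (G ⧸ N))).comap
      (QuotientGroup.mk' N) := by
  rw [← map_le_iff_le_comap, ← commutator_eq_bot_iff_le_centralizer, ← map_commutator,
    Subgroup.map_eq_bot_iff, QuotientGroup.ker_mk']

theorem iSup_commutator_le {ι : Sort*} {X : ι → Subgroup G} {Y N : Subgroup G} [N.Normal]
    (h : ∀ i, ⁅X i, Y⁆ ≤ N) : ⁅⨆ i, X i, Y⁆ ≤ N :=
  commutator_le_iff_le_comap_centralizer.2
    (iSup_le fun i => commutator_le_iff_le_comap_centralizer.1 (h i))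

theorem commutator_sup_le {X Y Z N : Subgroup G} [N.Normal] (hY : ⁅X, Y⁆ ≤ N) (hZ : ⁅X, Z⁆ ≤ N) :
    ⁅X, Y ⊔ Z⁆ ≤ N := by
  rw [commutator_comm, commutator_le_iff_le_comap_centralizer] at *
  exact sup_le hY hZ

/-- The lower central series of `S`, preceded by the whole group: an iterated commutator with at
least `n` entries in the normal subgroup `S` lies in the `n`-th term. In a group `A C`, an iterated
commutator of many elements has many entries in `A` or in `C`, whence Fitting's theorem. -/
def shiftedLowerCentralSeries (S : Subgroup G) : ℕ → Subgroup G
  | 0 => ⊤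
  | n + 1 => S.lowerCentralSeries n

instance shiftedLowerCentralSeries_normal (S : Subgroup G) [S.Normal] (n : ℕ) :
    (shiftedLowerCentralSeries S n).Normal := by
  cases n
  · exact inferInstanceAs (⊤ : Subgroup G).Normal
  · exact S.lowerCentralSeries_normal _

theorem commutator_shiftedLowerCentralSeries_le (S : Subgroup G) [S.Normal] (n : ℕ) :
    ⁅shiftedLowerCentralSeries S n, S⁆ ≤ shiftedLowerCentralSeries S (n + 1) := by
  cases n
  · exact commutator_le_right _ _
  · exact le_rfl

theorem lowerCentralSeries_le_iSup_inf {A C : Subgroup G} [A.Normal] [C.Normal] (h : A ⊔ C = ⊤)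
    (m : ℕ) : (⊤ : Subgroup G).lowerCentralSeries m ≤ ⨆ p : {p : ℕ × ℕ // p.1 + p.2 = m},
      shiftedLowerCentralSeries A p.1.1 ⊓ shiftedLowerCentralSeries C p.1.2 := by
  induction m with
  | zero => exact le_iSup_of_le ⟨(0, 0), rfl⟩ (le_inf le_rfl le_rfl)
  | succ m ih =>
    have := iSup_normal fun p : {p : ℕ × ℕ // p.1 + p.2 = m + 1} =>
      shiftedLowerCentralSeries A p.1.1 ⊓ shiftedLowerCentralSeries C p.1.2
    refine (commutator_mono ih le_rfl).trans (iSup_commutator_le ?_)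
    rintro ⟨⟨i, j⟩, rfl⟩
    rw [← h]
    refine commutator_sup_le ?_ ?_
    · refine le_iSup_of_le ⟨(i + 1, j), Nat.add_right_comm i 1 j⟩ (le_inf ?_ ?_)
      · exact (commutator_mono inf_le_left le_rfl).trans
          (commutator_shiftedLowerCentralSeries_le A i)
      · exact (commutator_mono inf_le_right le_rfl).trans (commutator_le_left _ _)
    · refine le_iSup_of_le ⟨(i, j + 1), rfl⟩ (le_inf ?_ ?_)
      · exact (commutator_mono inf_le_left le_rfl).trans (commutator_le_left _ _)
      · exact (commutator_mono inf_le_right le_rfl).trans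
          (commutator_shiftedLowerCentralSeries_le C j)

theorem isNilpotent_of_sup_eq_top {A C : Subgroup G} [A.Normal] [C.Normal]
    (hA : Group.IsNilpotent A) (hC : Group.IsNilpotent C) (h : A ⊔ C = ⊤) :
    Group.IsNilpotent G := by
  obtain ⟨a, ha⟩ := A.isNilpotent_iff_lowerCentralSeries.1 hA
  obtain ⟨c, hc⟩ := C.isNilpotent_iff_lowerCentralSeries.1 hC
  refine Subgroup.nilpotent_iff_lowerCentralSeries.2
    ⟨a + c + 1, le_bot_iff.1 ((lowerCentralSeries_le_iSup_inf h _).trans (iSup_le ?_))⟩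
  rintro ⟨⟨i, j⟩, hij : i + j = a + c + 1⟩
  obtain hi | hj : a < i ∨ c < j := by omega
  · obtain ⟨i, rfl⟩ := Nat.exists_eq_add_one_of_ne_zero hi.ne_bot
    exact inf_le_left.trans (ha ▸ A.lowerCentralSeries_antitone (Nat.le_of_lt_succ hi))
  · obtain ⟨j, rfl⟩ := Nat.exists_eq_add_one_of_ne_zero hj.ne_bot
    exact inf_le_right.trans (hc ▸ C.lowerCentralSeries_antitone (Nat.le_of_lt_succ hj))

theorem isNilpotent_of_le {A C : Subgroup G} (h : A ≤ C) (hC : Group.IsNilpotent C) :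
    Group.IsNilpotent A := by
  obtain ⟨c, hc⟩ := C.isNilpotent_iff_lowerCentralSeries.1 hC
  exact A.isNilpotent_iff_lowerCentralSeries.2 ⟨c, le_bot_iff.1 (hc ▸ lowerCentralSeries_mono c h)⟩

theorem isNilpotent_map {G' : Type*} [Group G'] {A : Subgroup G} (f : G →* G')
    (hA : Group.IsNilpotent A) : Group.IsNilpotent (A.map f) :=
  Group.nilpotent_of_surjective (h := hA) (f.subgroupMap A) (f.subgroupMap_surjective A)

theorem isNilpotent_sup {A C : Subgroup G} (hA : Group.IsNilpotent A) (hC : Group.IsNilpotent C)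
    (hCA : C ≤ normalizer (A : Set G)) (hAC : A ≤ normalizer (C : Set G)) :
    Group.IsNilpotent (A ⊔ C : Subgroup G) := by
  have hnA : (A.subgroupOf (A ⊔ C)).Normal :=
    normal_subgroupOf_iff_le_normalizer le_sup_left |>.2 (sup_le le_normalizer hCA)
  have hnC : (C.subgroupOf (A ⊔ C)).Normal :=
    normal_subgroupOf_iff_le_normalizer le_sup_right |>.2 (sup_le hAC le_normalizer)
  exact isNilpotent_of_sup_eq_top
    ((Group.isNilpotent_congr (subgroupOfEquivOfLe le_sup_left)).2 hA)
    ((Group.isNilpotent_congr (subgroupOfEquivOfLe le_sup_right)).2 hC)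
    (codisjoint_subgroupOf_sup A C).eq_top

theorem le_normalizer_biSup {ι : Type*} {s : Set ι} {X : Subgroup G} {Y : ι → Subgroup G}
    (h : ∀ i ∈ s, ⁅X, Y i⁆ ≤ ⨆ i ∈ s, Y i) :
    X ≤ normalizer ((⨆ i ∈ s, Y i : Subgroup G) : Set G) := by
  rw [le_normalizer_iff]
  intro x hx
  suffices (⨆ i ∈ s, Y i) ≤ (⨆ i ∈ s, Y i).comap (MulAut.conj x).toMonoidHom from this
  refine iSup₂_le fun i hi y hy => ?_
  rw [mem_comap, MulEquiv.coe_toMonoidHom, conj_eq_commutatorElement_mul]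
  exact mul_mem (h i hi (commutator_mem_commutator hx hy)) (le_biSup Y hi hy)

section IntervalFamily

variable {X : ℕ → Subgroup G} (hcomm : ∀ k l, k < l → ⁅X k, X l⁆ ≤ ⨆ j ∈ Set.Ioo k l, X j)

include hcomm

theorem biSup_Ico_succ_le_normalizer (p q : ℕ) : (⨆ j ∈ Set.Ico (p + 1) (q + 1), X j) ≤
    normalizer ((⨆ j ∈ Set.Ico p q, X j : Subgroup G) : Set G) := by
  refine iSup₂_le fun l hl => ?_
  obtain hlq | rfl := Nat.lt_succ_iff_lt_or_eq.1 hl.2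
  · have hl' : l ∈ Set.Ico p q := ⟨Nat.le_of_succ_le hl.1, hlq⟩
    exact (le_biSup X hl').trans le_normalizer
  · refine le_normalizer_biSup fun k hk => ?_
    rw [commutator_comm]
    exact (hcomm k l hk.2).trans (biSup_mono fun j hj => ⟨hk.1.trans hj.1.le, hj.2⟩)

theorem biSup_Ico_le_normalizer_succ (p q : ℕ) : (⨆ j ∈ Set.Ico p q, X j) ≤
    normalizer ((⨆ j ∈ Set.Ico (p + 1) (q + 1), X j : Subgroup G) : Set G) := by
  refine iSup₂_le fun k hk => ?_
  obtain rfl | hpk := hk.1.eq_or_lt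
  · exact le_normalizer_biSup fun l hl =>
      (hcomm p l hl.1).trans (biSup_mono fun j hj => ⟨hj.1, hj.2.trans hl.2⟩)
  · have hk' : k ∈ Set.Ico (p + 1) (q + 1) := ⟨hpk, Nat.lt_succ_of_lt hk.2⟩
    exact (le_biSup X hk').trans le_normalizer

theorem isNilpotent_biSup_Ico (hX : ∀ k, Group.IsNilpotent (X k)) (n p : ℕ) :
    Group.IsNilpotent (⨆ j ∈ Set.Ico p (p + n), X j : Subgroup G) := by
  induction n generalizing p with
  | zero => exact isNilpotent_of_le (C := ⊥) (by simp) inferInstance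
  | succ n ih =>
    obtain rfl | hn := n.eq_zero_or_pos
    · exact isNilpotent_of_le
        (iSup₂_le fun j hj => (le_antisymm hj.1 (Nat.le_of_lt_succ hj.2) ▸ le_rfl)) (hX p)
    have hright := ih (p + 1)
    rw [Nat.add_right_comm] at hright
    refine isNilpotent_of_le (iSup₂_le fun j hj => ?_) (isNilpotent_sup (ih p) hright
      (biSup_Ico_succ_le_normalizer hcomm p _) (biSup_Ico_le_normalizer_succ hcomm p _))
    obtain rfl | hpj := hj.1.eq_or_lt
    · exact le_sup_of_le_left (le_biSup X ⟨le_rfl, Nat.lt_add_of_pos_right hn⟩)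
    · exact le_sup_of_le_right (le_biSup X ⟨hpj, hj.2⟩)

end IntervalFamily

theorem eq_top_of_normalClosure_eq_top [hG : Group.IsNilpotent G] (A : Subgroup G)
    (h : normalClosure (A : Set G) = ⊤) : A = ⊤ := by
  revert A
  refine Group.nilpotent_center_quotient_ind
    (P := fun G _ _ => ∀ A : Subgroup G, normalClosure (A : Set G) = ⊤ → A = ⊤) G ?_ ?_
  · exact fun G _ _ A _ => Subsingleton.elim _ _
  · intro G _ _ ih A h
    have hmap : A.map (QuotientGroup.mk' (center G)) = ⊤ := by
      apply ih
      rw [coe_map, ← map_normalClosure _ _ (QuotientGroup.mk'_surjective _), h,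
        map_top_of_surjective _ (QuotientGroup.mk'_surjective _)]
    have hsup : A ⊔ center G = ⊤ := by
      rw [← QuotientGroup.ker_mk' (center G), ← comap_map_eq, hmap, comap_top]
    have hA : A.Normal := by
      rw [← normalizer_eq_top_iff, eq_top_iff, ← hsup]
      exact sup_le le_normalizer (center_le_normalizer _)
    rw [← h, normalClosure_eq_self]

theorem le_of_map_conj_eq {A C : Subgroup G} {g : G} (hg : g ∈ A ⊔ C)
    (hnil : Group.IsNilpotent (A ⊔ C : Subgroup G))
    (h : A.map (MulAut.conj g).toMonoidHom = C) : C ≤ A := by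
  suffices A.subgroupOf (A ⊔ C) = ⊤ from le_sup_right.trans (subgroupOf_eq_top.1 this)
  refine eq_top_of_normalClosure_eq_top _
    (eq_top_iff.2 ((codisjoint_subgroupOf_sup A C).eq_top ▸ sup_le le_normalClosure ?_))
  rintro ⟨c, hcK⟩ hc
  obtain ⟨a, ha, rfl⟩ := h.ge (mem_subgroupOf.1 hc)
  exact normalClosure_normal.conj_mem ⟨a, mem_sup_left ha⟩
    (le_normalClosure (mem_subgroupOf.2 ha)) ⟨g, hg⟩

/-- In a nilpotent group generated by two subgroups conjugate in it, each of them has normal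
closure the whole group, and a subgroup with this property is not proper. -/
theorem eq_of_map_conj_eq {A C : Subgroup G} {g : G} (hg : g ∈ A ⊔ C)
    (hnil : Group.IsNilpotent (A ⊔ C : Subgroup G))
    (h : A.map (MulAut.conj g).toMonoidHom = C) : A = C := by
  refine le_antisymm ?_ (le_of_map_conj_eq hg hnil h)
  rw [sup_comm] at hg hnil
  refine le_of_map_conj_eq (inv_mem hg) hnil ?_
  rw [← h, map_map]
  convert! A.map_id
  ext x
  simp [mul_assoc]

end NilpotentSubgroups

section Roots

variable {B W : Type*} [Group W] {M : CoxeterMatrix B} {cs : CoxeterSystem M W}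

theorem eq_simpleVec_of_refl_nonpos {c : B →₀ ℝ} {i : B} (hc : 0 ≤ c)
    (hrefl : refl M (simpleVec i) c ≤ 0) (hself : titsForm M c c = 1) : c = simpleVec i := by
  have hsingle : c = c i • simpleVec i := by
    ext l
    obtain rfl | hl := eq_or_ne l i
    · simp
    · have hle := hrefl l
      simp only [refl_apply, Finsupp.sub_apply, Finsupp.smul_apply,
        Finsupp.single_eq_of_ne hl, smul_zero, sub_zero] at hle
      simp [Finsupp.single_eq_of_ne hl, le_antisymm hle (hc l)]
  have hsq : c i * c i = 1 := by
    rw [hsingle, map_smul, map_smul, LinearMap.smul_apply, titsForm_simpleVec_self] at hself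
    simpa only [smul_eq_mul, mul_one] using hself
  have hi : c i = 1 := by nlinarith [show 0 ≤ c i from hc i]
  rw [hsingle, hi, one_smul]

theorem eq_smul_simpleHalf_of_crossing {γ : Set W} (hγ : cs.IsRoot γ) {x : W} {i : B}
    (hx : x ∈ γ) (hxi : x * cs.simple i ∉ γ) : γ = x • cs.simpleHalf i := by
  obtain ⟨w, j, rfl⟩ := hγ
  have hroot : geomRep cs (x⁻¹ * w) (simpleVec j) = simpleVec i := by
    refine eq_simpleVec_of_refl_nonpos (M := M) (mem_smul_simpleHalf_iff cs |>.1 hx) ?_ ?_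
    · rw [← geomRep_simple cs, ← geomRep_mul_apply, ← mul_assoc]
      rw [mem_smul_simpleHalf_iff, mul_inv_rev, cs.inv_simple] at hxi
      exact (((isRootVec_simpleVec cs j).geomRep _).nonneg_or_nonpos).resolve_left hxi
    · rw [titsForm_geomRep, titsForm_simpleVec_self]
  ext y
  rw [mem_smul_simpleHalf_iff, mem_smul_simpleHalf_iff, ← hroot, ← geomRep_mul_apply,
    mul_assoc, mul_inv_cancel_left]

theorem one_mem_simpleHalf (i : B) : (1 : W) ∈ cs.simpleHalf i := by
  simp [simpleHalf]

theorem simple_notMem_simpleHalf (i : B) : cs.simple i ∉ cs.simpleHalf i := by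
  simp [simpleHalf]

theorem simple_mem_simpleHalf_of_ne {i j : B} (h : i ≠ j) : cs.simple j ∈ cs.simpleHalf i := by
  rw [← one_smul W (cs.simpleHalf i), mem_smul_simpleHalf_iff, mul_one, cs.inv_simple,
    geomRep_simple, refl_simpleVec, sub_eq_add_neg, ← neg_smul]
  exact add_nonneg (Finsupp.single_nonneg.2 zero_le_one)
    (smul_nonneg (by linarith [titsMatrix_nonpos M h.symm]) (Finsupp.single_nonneg.2 zero_le_one))

theorem root_ext {α β : cs.Root} (h : α.1 = β.1) : α = β := Subtype.ext h

theorem translate_mul (v w : W) (β : cs.Root) :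
    Root.translate (v * w) β = Root.translate v (Root.translate w β) :=
  root_ext (mul_smul v w β.1)

theorem translate_one (β : cs.Root) : Root.translate 1 β = β := root_ext (one_smul W β.1)

theorem translate_opp (w : W) (β : cs.Root) :
    Root.translate w β.opp = (Root.translate w β).opp :=
  root_ext Set.smul_set_compl

theorem opp_opp (β : cs.Root) : β.opp.opp = β := root_ext (compl_compl β.1)

theorem translate_simple_simpleRoot (i : B) :
    Root.translate (cs.simple i) (cs.simpleRoot i) = (cs.simpleRoot i).opp :=
  root_ext (cs.compl_simpleHalf i).symm

theorem exists_eq_translate (α : cs.Root) : ∃ w i, α = Root.translate w (cs.simpleRoot i) := by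
  obtain ⟨α, w, i, rfl⟩ := α
  exact ⟨w, i, rfl⟩

theorem eq_simpleRoot_of_crossing {γ : cs.Root} {i : B} (h1 : 1 ∈ γ.1) (hi : cs.simple i ∉ γ.1) :
    γ = cs.simpleRoot i :=
  root_ext ((eq_smul_simpleHalf_of_crossing γ.2 h1 (by rwa [one_mul])).trans (one_smul _ _))

theorem prenilpotent_opp_simpleRoot {i j : B} (h : i ≠ j) :
    (cs.simpleRoot i).opp.Prenilpotent (cs.simpleRoot j) := by
  refine ⟨⟨cs.simple i, simple_notMem_simpleHalf i, simple_mem_simpleHalf_of_ne h.symm⟩,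
    ⟨cs.simple j, ?_, simple_notMem_simpleHalf j⟩⟩
  rw [opp_opp]
  exact simple_mem_simpleHalf_of_ne h

theorem openInterval_opp_simpleRoot {i j : B} (h : i ≠ j) :
    Root.openInterval (cs.simpleRoot i).opp (cs.simpleRoot j) = ∅ := by
  rw [Set.eq_empty_iff_forall_notMem]
  rintro γ ⟨⟨hinter, hinter_opp⟩, hne⟩
  have hi : cs.simple i ∈ γ.1 :=
    hinter ⟨simple_notMem_simpleHalf i, simple_mem_simpleHalf_of_ne h.symm⟩
  have hj : cs.simple j ∉ γ.1 := by
    refine hinter_opp ⟨?_, simple_notMem_simpleHalf j⟩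
    rw [opp_opp]
    exact simple_mem_simpleHalf_of_ne h
  apply hne
  by_cases h1 : (1 : W) ∈ γ.1
  · exact Or.inr (eq_simpleRoot_of_crossing h1 hj)
  · left
    rw [← opp_opp γ, eq_simpleRoot_of_crossing (γ := γ.opp) h1 (not_not.2 hi)]

end Roots

section Galleries

theorem exists_mem_notMem_succ {X : Type*} {z : ℕ → X} {s : Set X} {n : ℕ} (h0 : z 0 ∈ s)
    (hn : z n ∉ s) : ∃ k < n, z k ∈ s ∧ z (k + 1) ∉ s := by
  by_contra! hstep
  have hmem (k : ℕ) (hk : k ≤ n) : z k ∈ s := by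
    induction k with
    | zero => exact h0
    | succ k ih => exact hstep k hk (ih (Nat.le_of_succ_le hk))
  exact hn (hmem n le_rfl)

variable {B W : Type*} [Group W] {M : CoxeterMatrix B} (cs : CoxeterSystem M W)

/-- `z 0, …, z n` is a minimal gallery, that is, a geodesic in the Cayley graph of `(W, S)`. The
values of `z` beyond `n` are irrelevant. -/
def IsMinimalGallery (n : ℕ) (z : ℕ → W) : Prop :=
  ∀ k l, k ≤ l → l ≤ n → cs.length ((z k)⁻¹ * z l) = l - k

theorem exists_isMinimalGallery (x y : W) :
    ∃ (n : ℕ) (z : ℕ → W), IsMinimalGallery cs n z ∧ z 0 = x ∧ z n = y := by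
  obtain ⟨ω, hred, hω⟩ := cs.exists_isReduced (x⁻¹ * y)
  refine ⟨ω.length, fun k => x * cs.wordProd (ω.take k), fun k l hkl hl => ?_, by simp,
    by simp [← hω]⟩
  have hsplit : cs.wordProd (ω.take l) =
      cs.wordProd (ω.take k) * cs.wordProd ((ω.take l).drop k) := by
    rw [← min_eq_left hkl, ← List.take_take, ← cs.wordProd_append, min_eq_left hkl,
      List.take_append_drop]
  change cs.length ((x * cs.wordProd (ω.take k))⁻¹ * (x * cs.wordProd (ω.take l))) = l - k
  rw [hsplit, mul_inv_rev, mul_assoc, inv_mul_cancel_left, inv_mul_cancel_left,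
    ((hred.take l).drop k).eq, List.length_drop, List.length_take, min_eq_left hl]

variable {cs} {n : ℕ} {z : ℕ → W}

namespace IsMinimalGallery

variable (hz : IsMinimalGallery cs n z) {k : ℕ} (hk : k < n)

include hz hk

theorem exists_succ_eq_mul_simple : ∃ i, z (k + 1) = z k * cs.simple i := by
  have hlen := hz k (k + 1) k.le_succ hk
  rw [Nat.add_sub_cancel_left, cs.length_eq_one_iff] at hlen
  obtain ⟨i, hi⟩ := hlen
  exact ⟨i, by rw [← hi, mul_inv_cancel_left]⟩

theorem mem_smul_simpleHalf_iff {i : B} (hi : z (k + 1) = z k * cs.simple i) {l : ℕ} (hl : l ≤ n) :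
    z l ∈ z k • cs.simpleHalf i ↔ l ≤ k := by
  have hnext : cs.simple i * ((z k)⁻¹ * z l) = (z (k + 1))⁻¹ * z l := by
    rw [hi, mul_inv_rev, cs.inv_simple, mul_assoc]
  rw [Set.mem_smul_set_iff_inv_smul_mem, smul_eq_mul, simpleHalf, Set.mem_ofPred_eq, hnext]
  obtain hlk | hkl := le_or_gt l k
  · have hlen (m : ℕ) (hlm : l ≤ m) (hm : m ≤ n) : cs.length ((z m)⁻¹ * z l) = m - l := by
      rw [← cs.length_inv, mul_inv_rev, inv_inv, hz l m hlm hm]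
    rw [hlen k hlk hk.le, hlen (k + 1) (by omega) hk]
    omega
  · rw [hz k l hkl.le hl, hz (k + 1) l hkl hl]
    omega

theorem mem_iff_of_crossing {γ : cs.Root} (hkγ : z k ∈ γ.1) (hkγ' : z (k + 1) ∉ γ.1) {l : ℕ}
    (hl : l ≤ n) : z l ∈ γ.1 ↔ l ≤ k := by
  obtain ⟨i, hi⟩ := hz.exists_succ_eq_mul_simple hk
  rw [eq_smul_simpleHalf_of_crossing γ.2 hkγ (hi ▸ hkγ')]
  exact hz.mem_smul_simpleHalf_iff hk hi hl

theorem eq_of_crossing {γ δ : cs.Root} (hγ : z k ∈ γ.1) (hγ' : z (k + 1) ∉ γ.1)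
    (hδ : z k ∈ δ.1) (hδ' : z (k + 1) ∉ δ.1) : γ = δ := by
  obtain ⟨i, hi⟩ := hz.exists_succ_eq_mul_simple hk
  rw [hi] at hγ' hδ'
  exact root_ext ((eq_smul_simpleHalf_of_crossing γ.2 hγ hγ').trans
    (eq_smul_simpleHalf_of_crossing δ.2 hδ hδ').symm)

end IsMinimalGallery

end Galleries

section SeparatingRoots

variable {B W G : Type*} [Group W] [Group G] {M : CoxeterMatrix B} {cs : CoxeterSystem M W}
  {U : cs.Root → Subgroup G} {n : ℕ} {z : ℕ → W}

variable (U n z) in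
/-- The root group of the root that the gallery `z 0, …, z n` leaves when it moves from `z k` to
`z (k + 1)`, trivial for `n ≤ k`. On a minimal gallery the supremum has a single term if `k < n`. -/
def stepGroup (k : ℕ) : Subgroup G :=
  ⨆ (γ : cs.Root) (_ : k < n ∧ z k ∈ γ.1 ∧ z (k + 1) ∉ γ.1), U γ

theorem stepGroup_eq_bot {k : ℕ} (hk : n ≤ k) : stepGroup U n z k = ⊥ :=
  le_bot_iff.1 (iSup₂_le fun _ h => absurd h.1 hk.not_gt)

theorem le_biSup_stepGroup {γ : cs.Root} (hγ : z 0 ∈ γ.1) (hγ' : z n ∉ γ.1) :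
    U γ ≤ ⨆ k ∈ Set.Ico 0 (0 + n), stepGroup U n z k := by
  obtain ⟨k, hk, hcross⟩ := exists_mem_notMem_succ hγ hγ'
  exact le_iSup₂_of_le k (by simpa using hk) (le_iSup₂_of_le γ ⟨hk, hcross⟩ le_rfl)

namespace IsMinimalGallery

variable (hz : IsMinimalGallery cs n z)

include hz

theorem exists_crossing {k : ℕ} (hk : k < n) :
    ∃ γ : cs.Root, z k ∈ γ.1 ∧ z (k + 1) ∉ γ.1 := by
  obtain ⟨i, hi⟩ := hz.exists_succ_eq_mul_simple hk
  refine ⟨⟨z k • cs.simpleHalf i, z k, i, rfl⟩, ?_, ?_⟩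
  · exact (hz.mem_smul_simpleHalf_iff hk hi hk.le).2 le_rfl
  · exact fun h => k.lt_irrefl ((hz.mem_smul_simpleHalf_iff hk hi hk).1 h)

theorem stepGroup_eq {k : ℕ} (hk : k < n) {γ : cs.Root} (hγ : z k ∈ γ.1)
    (hγ' : z (k + 1) ∉ γ.1) : stepGroup U n z k = U γ :=
  le_antisymm
    (iSup₂_le fun _ hδ => (congrArg U (hz.eq_of_crossing hk hδ.2.1 hδ.2.2 hγ hγ')).le)
    (le_iSup₂_of_le γ ⟨hk, hγ, hγ'⟩ le_rfl)

theorem stepGroup_isNilpotent (hnil : ∀ γ : cs.Root, Group.IsNilpotent (U γ)) (k : ℕ) :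
    Group.IsNilpotent (stepGroup U n z k) := by
  obtain hk | hk := lt_or_ge k n
  · obtain ⟨γ, hγ, hγ'⟩ := hz.exists_crossing hk
    rw [hz.stepGroup_eq hk hγ hγ']
    exact hnil γ
  · rw [stepGroup_eq_bot hk]
    infer_instance

theorem exists_crossing_of_mem_openInterval {k l : ℕ} (hkl : k < l) (hl : l < n) {γ δ ε : cs.Root}
    (hγ : z k ∈ γ.1) (hγ' : z (k + 1) ∉ γ.1) (hδ : z l ∈ δ.1) (hδ' : z (l + 1) ∉ δ.1)
    (hε : ε ∈ Root.openInterval γ δ) : ∃ m ∈ Set.Ioo k l, z m ∈ ε.1 ∧ z (m + 1) ∉ ε.1 := by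
  obtain ⟨⟨hinter, hinter_opp⟩, hne⟩ := hε
  have memγ {m : ℕ} (hm : m ≤ n) := hz.mem_iff_of_crossing (hkl.trans hl) hγ hγ' hm
  have memδ {m : ℕ} (hm : m ≤ n) := hz.mem_iff_of_crossing hl hδ hδ' hm
  have h0 : z 0 ∈ ε.1 := hinter ⟨(memγ n.zero_le).2 k.zero_le, (memδ n.zero_le).2 l.zero_le⟩
  have hn : z n ∉ ε.1 := hinter_opp
    ⟨fun h => by have := (memγ le_rfl).1 h; omega, fun h => by have := (memδ le_rfl).1 h; omega⟩
  obtain ⟨m, hm, hmε, hmε'⟩ := exists_mem_notMem_succ h0 hn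
  have memε {j : ℕ} (hj : j ≤ n) := hz.mem_iff_of_crossing hm hmε hmε' hj
  have hkm : k ≤ m := (memε (by omega)).1 (hinter ⟨hγ, (memδ (by omega)).2 hkl.le⟩)
  have hml : m ≤ l := by
    by_contra! hlm
    exact hinter_opp ⟨fun h => by have := (memγ hl).1 h; omega, hδ'⟩ ((memε hl).2 hlm)
  have hmk : m ≠ k := by
    rintro rfl
    exact hne (Or.inl (hz.eq_of_crossing hm hmε hmε' hγ hγ'))
  have hml' : m ≠ l := by
    rintro rfl
    exact hne (Or.inr (hz.eq_of_crossing hm hmε hmε' hδ hδ'))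
  exact ⟨m, ⟨by omega, by omega⟩, hmε, hmε'⟩

theorem commutator_stepGroup_le (hU : IsTwinRootDatum U) {k l : ℕ} (hkl : k < l) :
    ⁅stepGroup U n z k, stepGroup U n z l⁆ ≤ ⨆ m ∈ Set.Ioo k l, stepGroup U n z m := by
  obtain hl | hl := le_or_gt n l
  · rw [stepGroup_eq_bot hl, Subgroup.commutator_bot_right]
    exact bot_le
  obtain ⟨γ, hγ, hγ'⟩ := hz.exists_crossing (hkl.trans hl)
  obtain ⟨δ, hδ, hδ'⟩ := hz.exists_crossing hl
  have memγ {m : ℕ} (hm : m ≤ n) := hz.mem_iff_of_crossing (hkl.trans hl) hγ hγ' hm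
  have memδ {m : ℕ} (hm : m ≤ n) := hz.mem_iff_of_crossing hl hδ hδ' hm
  have hlγ : z l ∉ γ.1 := fun h => ((memγ hl.le).1 h).not_gt hkl
  have hlγ' : z (l + 1) ∉ γ.1 := fun h => by have := (memγ hl).1 h; omega
  have hpre : γ.Prenilpotent δ :=
    ⟨⟨z k, hγ, (memδ (by omega)).2 hkl.le⟩, ⟨z (l + 1), hlγ', hδ'⟩⟩
  rw [hz.stepGroup_eq (hkl.trans hl) hγ hγ', hz.stepGroup_eq hl hδ hδ']
  refine (hU.commutator_le γ δ (fun h => hlγ (h ▸ hδ)) hpre).trans (iSup₂_le fun ε hε => ?_)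
  obtain ⟨m, hm, hmε, hmε'⟩ := hz.exists_crossing_of_mem_openInterval hkl hl hγ hγ' hδ hδ' hε
  exact le_iSup₂_of_le m hm (hz.stepGroup_eq (hm.2.trans hl) hmε hmε').ge

end IsMinimalGallery

theorem IsTwinRootDatum.isNilpotent_separating (hU : IsTwinRootDatum U)
    (hnil : ∀ γ : cs.Root, Group.IsNilpotent (U γ)) (x y : W) :
    Group.IsNilpotent ↥(⨆ (γ : cs.Root) (_ : x ∈ γ.1 ∧ y ∉ γ.1), U γ) := by
  obtain ⟨n, z, hz, rfl, rfl⟩ := exists_isMinimalGallery cs x y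
  exact isNilpotent_of_le (iSup₂_le fun γ hγ => le_biSup_stepGroup hγ.1 hγ.2)
    (isNilpotent_biSup_Ico (fun k l => hz.commutator_stepGroup_le hU)
      (hz.stepGroup_isNilpotent hnil) n 0)

theorem IsTwinRootDatum.isNilpotent_sup_of_prenilpotent (hU : IsTwinRootDatum U)
    (hnil : ∀ γ : cs.Root, Group.IsNilpotent (U γ)) {α β : cs.Root} (h : α.Prenilpotent β) :
    Group.IsNilpotent ↥(U α ⊔ U β) := by
  obtain ⟨⟨x, hxα, hxβ⟩, ⟨y, hyα, hyβ⟩⟩ := h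
  exact isNilpotent_of_le
    (sup_le (le_iSup₂_of_le α ⟨hxα, hyα⟩ le_rfl) (le_iSup₂_of_le β ⟨hxβ, hyβ⟩ le_rfl))
    (hU.isNilpotent_separating hnil x y)

end SeparatingRoots

section WeylGroupAction

variable {B W G : Type*} [Group W] [Group G] {M : CoxeterMatrix B} {cs : CoxeterSystem M W}
  {U : cs.Root → Subgroup G}

variable (U) in
/-- Conjugation by `n` permutes the root groups as `w` permutes the roots. This is how elements of
`N` are related to elements of `W`, without identifying `W` with `N / T`. -/
def LiftsTo (n : G) (w : W) : Prop :=
  ∀ β : cs.Root, (U β).map (MulAut.conj n).toMonoidHom = U (Root.translate w β)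

theorem LiftsTo.mul {m n : G} {v w : W} (hm : LiftsTo U m v) (hn : LiftsTo U n w) :
    LiftsTo U (m * n) (v * w) := by
  intro β
  rw [translate_mul, ← hm, ← hn, Subgroup.map_map]
  congr 1
  ext x
  simp [mul_assoc]

theorem LiftsTo.inv {n : G} {w : W} (hn : LiftsTo U n w) : LiftsTo U n⁻¹ w⁻¹ := by
  intro β
  have hβ := hn (Root.translate w⁻¹ β)
  rw [← translate_mul, mul_inv_cancel, translate_one] at hβ
  rw [← hβ, Subgroup.map_map]
  convert! Subgroup.map_id _
  ext x
  simp [mul_assoc]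

theorem liftsTo_one_of_mem_torus {t : G} (ht : t ∈ torus U) : LiftsTo U t 1 := fun β => by
  rw [translate_one]
  exact Subgroup.mem_normalizer_iff_map_conj_eq.1 (Subgroup.mem_iInf.1 ht β)

namespace IsTwinRootDatum

variable (hU : IsTwinRootDatum U)

include hU

theorem exists_liftsTo_simple (i : B) :
    ∃ m ∈ weylNormalizer U, LiftsTo U m (cs.simple i) ∧
      m ∈ U (cs.simpleRoot i) ⊔ U (cs.simpleRoot i).opp := by
  obtain ⟨u, hu, hu1⟩ := (U (cs.simpleRoot i)).bot_or_exists_ne_one.resolve_left (hU.ne_bot _)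
  obtain ⟨m, hm⟩ := hU.exists_weylLift i u hu hu1
  refine ⟨m, Subgroup.mem_sup_right (Subgroup.subset_closure ⟨i, u, hu, hu1, hm⟩), hm.2, ?_⟩
  obtain ⟨u', hu', u'', hu'', rfl⟩ := hm.1
  exact mul_mem (mul_mem (Subgroup.mem_sup_right hu') (Subgroup.mem_sup_left hu))
    (Subgroup.mem_sup_right hu'')

theorem exists_liftsTo (w : W) : ∃ n ∈ weylNormalizer U, LiftsTo U n w := by
  induction w using cs.simple_induction_left with
  | one => exact ⟨1, one_mem _, liftsTo_one_of_mem_torus (one_mem _)⟩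
  | mul_simple_left w i ih =>
    obtain ⟨n, hn, hnw⟩ := ih
    obtain ⟨m, hm, hmi, -⟩ := hU.exists_liftsTo_simple i
    exact ⟨m * n, mul_mem hm hn, hmi.mul hnw⟩

theorem isNilpotent (hnil : ∀ i : B, Group.IsNilpotent (U (cs.simpleRoot i))) (γ : cs.Root) :
    Group.IsNilpotent (U γ) := by
  obtain ⟨w, i, rfl⟩ := exists_eq_translate γ
  obtain ⟨n, -, hn⟩ := hU.exists_liftsTo w
  rw [← hn]
  exact isNilpotent_map _ (hnil i)

end IsTwinRootDatum

variable (U) in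
/-- The image of `N ∩ H` in the Weyl group `W`: the elements of `W` having a lift in `N ∩ H`. -/
def weylImage (H : Subgroup G) : Subgroup W where
  carrier := {w | ∃ n ∈ weylNormalizer U ⊓ H, LiftsTo U n w}
  one_mem' := ⟨1, one_mem _, liftsTo_one_of_mem_torus (one_mem _)⟩
  mul_mem' := by
    rintro v w ⟨m, hm, hmv⟩ ⟨n, hn, hnw⟩
    exact ⟨m * n, mul_mem hm hn, hmv.mul hnw⟩
  inv_mem' := by
    rintro w ⟨n, hn, hnw⟩
    exact ⟨n⁻¹, inv_mem hn, hnw.inv⟩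

variable {H : Subgroup G} [H.Normal]

theorem mem_weylImage_of_liftsTo {n : G} {w : W} (hnw : LiftsTo U n w)
    (hn : n ∈ torus U ⊔ (weylNormalizer U ⊓ H)) : w ∈ weylImage U H := by
  have hT : torus U ≤ weylNormalizer U := le_sup_left
  have hnN : n ∈ weylNormalizer U := sup_le hT inf_le_left hn
  obtain ⟨t, ht, h, hh, rfl⟩ :=
    Subgroup.mem_sup_of_normal_right.1 (sup_le_sup_left inf_le_right (torus U) hn)
  refine ⟨h, ⟨(Subgroup.mul_mem_cancel_left _ (hT ht)).1 hnN, hh⟩, ?_⟩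
  simpa only [inv_one, one_mul, inv_mul_cancel_left] using
    (liftsTo_one_of_mem_torus ht).inv.mul hnw

theorem IsTwinRootDatum.weylImage_normal (hU : IsTwinRootDatum U) : (weylImage U H).Normal := by
  refine ⟨?_⟩
  rintro w ⟨n, hn, hnw⟩ v
  obtain ⟨m, hm, hmv⟩ := hU.exists_liftsTo v
  exact ⟨m * n * m⁻¹, Subgroup.mem_inf.2 ⟨mul_mem (mul_mem hm hn.1) (inv_mem hm),
    Subgroup.Normal.conj_mem ‹_› n hn.2 m⟩, (hmv.mul hnw).mul hmv.inv⟩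

theorem IsTwinRootDatum.weylImage_finiteIndex (hU : IsTwinRootDatum U)
    (hfin : Finite (weylNormalizer U ⧸
      (torus U ⊔ (weylNormalizer U ⊓ H)).subgroupOf (weylNormalizer U))) :
    (weylImage U H).FiniteIndex := by
  choose n hn hnw using hU.exists_liftsTo
  have hinj : Function.Injective fun q : W ⧸ weylImage U H =>
      (QuotientGroup.mk ⟨n q.out, hn q.out⟩ : weylNormalizer U ⧸
        (torus U ⊔ (weylNormalizer U ⊓ H)).subgroupOf (weylNormalizer U)) := by
    intro p q hpq
    rw [← p.out_eq', ← q.out_eq']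
    have hmem : (n p.out)⁻¹ * n q.out ∈ torus U ⊔ (weylNormalizer U ⊓ H) :=
      Subgroup.mem_subgroupOf.1 (QuotientGroup.eq.1 hpq)
    exact QuotientGroup.eq.2 (mem_weylImage_of_liftsTo ((hnw p.out).inv.mul (hnw q.out)) hmem)
  have := Finite.of_injective _ hinj
  exact Subgroup.finiteIndex_of_finite_quotient

end WeylGroupAction

section RootGroupsModulo

variable {B W G : Type*} [Group W] [Group G] {M : CoxeterMatrix B} {cs : CoxeterSystem M W}
  {U : cs.Root → Subgroup G} {H : Subgroup G} [H.Normal]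

theorem LiftsTo.map_mk' {n : G} {w : W} (h : LiftsTo U n w) (β : cs.Root) :
    ((U β).map (QuotientGroup.mk' H)).map (MulAut.conj (n : G ⧸ H)).toMonoidHom =
      (U (Root.translate w β)).map (QuotientGroup.mk' H) := by
  rw [← h, Subgroup.map_map, Subgroup.map_map]
  rfl

theorem map_mk'_translate_eq {w : W} (hw : w ∈ weylImage U H) (β : cs.Root) :
    (U (Root.translate w β)).map (QuotientGroup.mk' H) = (U β).map (QuotientGroup.mk' H) := by
  obtain ⟨n, hn, hnw⟩ := hw
  rw [← hnw.map_mk', (QuotientGroup.eq_one_iff n).2 hn.2, map_one]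
  exact Subgroup.map_id _

namespace IsTwinRootDatum

variable (hU : IsTwinRootDatum U)

include hU

theorem map_mk'_opp_eq (hirr : M.IsIrreducible) (hpos : ¬ M.titsMatrix.PosSemidef)
    (hnil : ∀ i : B, Group.IsNilpotent (U (cs.simpleRoot i)))
    (hfin : Finite (weylNormalizer U ⧸
      (torus U ⊔ (weylNormalizer U ⊓ H)).subgroupOf (weylNormalizer U))) (i : B) :
    (U (cs.simpleRoot i).opp).map (QuotientGroup.mk' H) =
      (U (cs.simpleRoot i)).map (QuotientGroup.mk' H) := by
  have := hU.weylImage_normal (H := H)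
  have := hU.weylImage_finiteIndex hfin
  obtain ⟨w, hw, hnot, hnot'⟩ := exists_mem_not_nested cs hirr hpos (weylImage U H) i
  obtain ⟨x, hx, hx'⟩ := Set.not_subset.1 hnot
  obtain ⟨y, hy, hy'⟩ := Set.not_subset.1 hnot'
  have hpre : (cs.simpleRoot i).Prenilpotent (Root.translate w (cs.simpleRoot i).opp) := by
    rw [translate_opp]
    exact ⟨⟨x, hx, hx'⟩, ⟨y, hy', not_not.2 hy⟩⟩
  obtain ⟨m, -, hm, hmem⟩ := hU.exists_liftsTo_simple i
  refine (eq_of_map_conj_eq (g := (m : G ⧸ H)) ?_ ?_ ?_).symm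
  · rw [← Subgroup.map_sup]
    exact Subgroup.mem_map_of_mem (QuotientGroup.mk' H) hmem
  · rw [← map_mk'_translate_eq hw (cs.simpleRoot i).opp, ← Subgroup.map_sup]
    exact isNilpotent_map _ (hU.isNilpotent_sup_of_prenilpotent (hU.isNilpotent hnil) hpre)
  · rw [hm.map_mk', translate_simple_simpleRoot]

theorem map_mk'_dagger_le (hopp : ∀ i : B, (U (cs.simpleRoot i).opp).map (QuotientGroup.mk' H) =
      (U (cs.simpleRoot i)).map (QuotientGroup.mk' H)) :
    (dagger U).map (QuotientGroup.mk' H) ≤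
      ⨆ i : B, (U (cs.simpleRoot i)).map (QuotientGroup.mk' H) := by
  rw [dagger, Subgroup.map_iSup]
  refine iSup_le fun β => ?_
  obtain ⟨w, j, rfl⟩ := exists_eq_translate β
  induction w using cs.simple_induction_left with
  | one =>
    rw [translate_one]
    exact le_iSup (fun i => (U (cs.simpleRoot i)).map (QuotientGroup.mk' H)) j
  | mul_simple_left w i ih =>
    obtain ⟨m, -, hm, hmem⟩ := hU.exists_liftsTo_simple i
    have hmi : (m : G ⧸ H) ∈ ⨆ i, (U (cs.simpleRoot i)).map (QuotientGroup.mk' H) := by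
      refine Subgroup.mem_iSup_of_mem i ?_
      have := Subgroup.mem_map_of_mem (QuotientGroup.mk' H) hmem
      rwa [Subgroup.map_sup, hopp, sup_idem] at this
    rw [translate_mul, ← hm.map_mk', Subgroup.map_le_iff_le_comap]
    exact fun x hx => mul_mem (mul_mem hmi (ih hx)) (inv_mem hmi)

theorem commute_mk {i j : B} (hij : i ≠ j)
    (hopp : (U (cs.simpleRoot i).opp).map (QuotientGroup.mk' H) =
      (U (cs.simpleRoot i)).map (QuotientGroup.mk' H)) {x y : G}
    (hx : x ∈ U (cs.simpleRoot i)) (hy : y ∈ U (cs.simpleRoot j)) :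
    Commute (x : G ⧸ H) (y : G ⧸ H) := by
  obtain ⟨x', hx', heq⟩ : (x : G ⧸ H) ∈ (U (cs.simpleRoot i).opp).map (QuotientGroup.mk' H) :=
    hopp ▸ Subgroup.mem_map_of_mem (QuotientGroup.mk' H) hx
  have hne : (cs.simpleRoot i).opp ≠ cs.simpleRoot j := fun h =>
    (h ▸ one_mem_simpleHalf j : (1 : W) ∈ (cs.simpleRoot i).opp.1) (one_mem_simpleHalf i)
  have hcomm := hU.commutator_le _ _ hne (prenilpotent_opp_simpleRoot hij)
    (Subgroup.commutator_mem_commutator hx' hy)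
  simp only [openInterval_opp_simpleRoot hij, Set.mem_empty_iff_false, iSup_false, iSup_bot,
    Subgroup.mem_bot] at hcomm
  rw [← heq]
  exact (commutatorElement_eq_one_iff_commute.1 hcomm).map (QuotientGroup.mk' H)

end IsTwinRootDatum

end RootGroupsModulo

section Dagger

/-- The embedding `D / (H ∩ D) → G / H` induced by the inclusion of the subgroup `D`. -/
def quotientSubgroupOfMap {G : Type*} [Group G] (D H : Subgroup G) [H.Normal] :
    D ⧸ H.subgroupOf D →* G ⧸ H :=
  QuotientGroup.map (H.subgroupOf D) H D.subtype (H.comap_subtype D).ge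

theorem quotientSubgroupOfMap_injective {G : Type*} [Group G] (D H : Subgroup G) [H.Normal] :
    Function.Injective (quotientSubgroupOfMap D H) := by
  rw [← MonoidHom.ker_eq_bot_iff, quotientSubgroupOfMap, QuotientGroup.ker_map]
  exact QuotientGroup.map_mk'_self _

theorem noncommPiCoprod_eq_list_prod {ι P : Type*} [Fintype ι] [Monoid P] {K : ι → Type*}
    [∀ i, Monoid (K i)] {ψ : ∀ i, K i →* P}
    (hcomm : Pairwise fun i j => ∀ x y, Commute (ψ i x) (ψ j y)) {l : List ι} (hl : l.Nodup)
    (hmem : ∀ i, i ∈ l) (u : ∀ i, K i) :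
    MonoidHom.noncommPiCoprod ψ hcomm u = (l.map fun i => ψ i (u i)).prod := by
  classical
  have huniv : l.toFinset = Finset.univ :=
    Finset.eq_univ_iff_forall.2 fun i => List.mem_toFinset.2 (hmem i)
  rw [MonoidHom.noncommPiCoprod_apply]
  simp only [← huniv]
  exact Finset.noncommProd_toFinset l _ _ hl

variable {B W G : Type*} [Group W] [Group G] {M : CoxeterMatrix B} {cs : CoxeterSystem M W}
  (U : cs.Root → Subgroup G) (H : Subgroup G) [H.Normal]

/-- The homomorphism `U_{α_i} → G† / (H ∩ G†)`. -/
def simpleRootProj (i : B) :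
    U (cs.simpleRoot i) →* dagger U ⧸ H.subgroupOf (dagger U) :=
  (daggerProj U H).comp (toDagger U (cs.simpleRoot i))

variable {U H} (hU : IsTwinRootDatum U)
  (hopp : ∀ i : B, (U (cs.simpleRoot i).opp).map (QuotientGroup.mk' H) =
    (U (cs.simpleRoot i)).map (QuotientGroup.mk' H))

include hU hopp

theorem IsTwinRootDatum.pairwise_commute_simpleRootProj :
    Pairwise fun i j => ∀ x y, Commute (simpleRootProj U H i x) (simpleRootProj U H j y) :=
  fun i _ hij x y => quotientSubgroupOfMap_injective (dagger U) H (by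
    rw [map_mul, map_mul]
    exact hU.commute_mk hij (hopp i) x.2 y.2)

theorem IsTwinRootDatum.iSup_range_simpleRootProj : ⨆ i, (simpleRootProj U H i).range = ⊤ := by
  have hrange (i : B) : (simpleRootProj U H i).range.map (quotientSubgroupOfMap (dagger U) H) =
      (U (cs.simpleRoot i)).map (QuotientGroup.mk' H) := by
    rw [MonoidHom.map_range, ← MonoidHom.domRestrict_range]
    rfl
  rw [eq_top_iff,
    ← Subgroup.map_le_map_iff_of_injective (quotientSubgroupOfMap_injective (dagger U) H),
    Subgroup.map_iSup, iSup_congr hrange]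
  rintro - ⟨q, -, rfl⟩
  induction q using QuotientGroup.induction_on with
  | H d => exact hU.map_mk'_dagger_le hopp ⟨d, d.2, rfl⟩

end Dagger

end RootGroups

end

theorem mainTheorem5 {B W G : Type*} [Finite B] [Group W] [Group G] {M : CoxeterMatrix B}
    (cs : CoxeterSystem M W) (U : cs.Root → Subgroup G)
    (hU : RootGroups.IsTwinRootDatum U)
    (hirr : M.IsIrreducible) (hsph : ¬ cs.IsSpherical) (haff : ¬ cs.IsAffine)
    (hnil : ∀ i : B, Group.IsNilpotent (U (cs.simpleRoot i)))
    (H : Subgroup G) [H.Normal]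
    (hfin : Finite (RootGroups.weylNormalizer U ⧸
      (RootGroups.torus U ⊔ (RootGroups.weylNormalizer U ⊓ H)).subgroupOf
        (RootGroups.weylNormalizer U))) :
    (∃ φ : (∀ i : B, U (cs.simpleRoot i)) →*
        RootGroups.dagger U ⧸ H.subgroupOf (RootGroups.dagger U),
      Function.Surjective φ ∧
      -- `φ` is the composed map, whatever the order in which the product is taken
      ∀ l : List B, l.Nodup → (∀ i, i ∈ l) → ∀ u : (∀ i : B, U (cs.simpleRoot i)),
        φ u = RootGroups.daggerProj U H
          (l.map fun i => RootGroups.toDagger U (cs.simpleRoot i) (u i)).prod) ∧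
    Group.IsNilpotent (RootGroups.dagger U ⧸ H.subgroupOf (RootGroups.dagger U)) := by
  have := Fintype.ofFinite B
  have hpos : ¬ M.titsMatrix.PosSemidef := fun h => haff ⟨hsph, h⟩
  have hopp := hU.map_mk'_opp_eq hirr hpos hnil hfin
  have hcomm := hU.pairwise_commute_simpleRootProj hopp
  have hsurj : Function.Surjective (MonoidHom.noncommPiCoprod _ hcomm) := by
    rw [← MonoidHom.range_eq_top, MonoidHom.noncommPiCoprod_range,
      hU.iSup_range_simpleRootProj hopp]
  refine ⟨⟨MonoidHom.noncommPiCoprod _ hcomm, hsurj, fun l hl hmem u => ?_⟩,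
    Group.nilpotent_of_surjective _ hsurj⟩
  rw [RootGroups.noncommPiCoprod_eq_list_prod hcomm hl hmem, map_list_prod, List.map_map]
  rfl
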